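/- **Setting.** 1-types are represented by groupoids (a set is a discrete groupoid). Fix a universe of small sets, a small index set $I$, and a family $(K_i)_{i\in I}$ of small groupoids: the constant 1-types that may be used. *Polynomial codes* are generated by $\mathsf C(i)$ ($i\in I$), $\mathsf{Id}$, $P+Q$, $P\times Q$. A code $P$ acts on sets $X$ (with $\mathsf C(i)(X)$ the set of objects of $K_i$), and on groupoids, functors and natural transformations, by constant $K_i$, identity, disjoint union and product. *Path endpoints* $e\in E_A(P,Q)$ are generated by $\mathsf{id}\in E_A(P,P)$; composites $e_1\cdot e_2$; $\mathsf{constr}\in E_A(A,\mathsf{Id})$; the injections, projections and pairings for $+$, $\times$; $\mathsf C(x)\in E_A(P,\mathsf C(i))$ for objects $x$ of $K_i$; and $\mathsf{fmap}(F)\in E_A(\mathsf C(i),\mathsf C(j))$ for functors $F:K_i\to K_j$. Given a map (functor) $c:A(X)\to X$, each $e$ induces a map (functor) $e:P(X)\to Q(X)$. *Homotopy endpoints*, given a set $J$, endpoints $l_j,r_j\in E_A(Q_j,\mathsf{Id})$ ($j\in J$) and $a,b\in E_A(R,T)$, are formal paths $s\Rightarrow t$ between endpoints $s,t\in E_A(R,W)$.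 They are generated by reflexivity, inverse, concatenation; application $e_1\cdot e\Rightarrow e_2\cdot e$ of an endpoint $e$ to $h:e_1\Rightarrow e_2$; associativity and unit laws of $\cdot$; $\langle e_1,e_2\rangle\cdot\pi_k\Rightarrow e_k$; pairing; $e_1\cdot\langle e_2,e_3\rangle\Rightarrow\langle e_1\cdot e_2,e_1\cdot e_3\rangle$; $e\cdot\mathsf C(x)\Rightarrow\mathsf C(x)$; $\mathsf{path}(j,e):e\cdot l_j\Rightarrow e\cdot r_j$; $\mathsf{arg}:a\Rightarrow b$; and, for paths in the constants, $\mathsf C(x)\Rightarrow\mathsf C(y)$ for every morphism $x\to y$ of $K_i$ and $e\cdot\mathsf{fmap}(F)\Rightarrow e\cdot\mathsf{fmap}(G)$ for every natural transformation $F\Rightarrow G$. In a groupoid $X$ with a functor $c:A(X)\to X$ and natural transformations $p_j:l_j\Rightarrow r_j$, a homotopy endpoint $h:s\Rightarrow t$ assigns to every object $x\in R(X)$ and morphism $w:a(x)\to b(x)$ a morphism $h(x,w):s(x)\to t(x)$, by recursion on $h$ in the evident way. A *signature* $\Sigma$ consists of a code $A$; a small set $J$ with codes $Q_j$ and endpoints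 $l_j,r_j\in E_A(Q_j,\mathsf{Id})$; and a small set $H$ with, for each $k\in H$, codes $R_k,T_k$, endpoints $a_k,b_k\in E_A(R_k,T_k)$ and $s_k,t_k\in E_A(R_k,\mathsf{Id})$, and homotopy endpoints $\lambda_k,\rho_k:s_k\Rightarrow t_k$ over $(l,r,a_k,b_k)$. The *bicategory of groupoid algebras* for $\Sigma$ (underlying groupoids small) is as follows. * Objects: groupoids $X$ with a functor $c_X:A(X)\to X$ and natural transformations $p^X_j:l_j\Rightarrow r_j$ between the functors $Q_j(X)\to X$ induced by $l_j$ and $r_j$, such that $\lambda_k(x,w)=\rho_k(x,w)$ for all $k\in H$, $x\in R_k(X)$, $w:a_k(x)\to b_k(x)$. * 1-cells $X\to Y$: functors $f$ with a natural isomorphism $\bar f_x:f(c_X(x))\to c_Y(A(f)(x))$ such that $f(p^X_j(x))$ followed by $r_j(\bar f)_x$ equals $l_j(\bar f)_x$ followed by $p^Y_j(Q_j(f)(x))$. Here $e(\bar f)_x:Q(f)(e(x))\to e(P(f)(x))$ is the pseudonaturality cell of an endpoint $e\in E_A(P,Q)$, obtained from $\bar f$ by recursion on $e$. * 2-cells $f\Rightarrow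 g$: natural transformations $\theta$ such that $\theta_{c_X(x)}$ followed by $\bar g_x$ equals $\bar f_x$ followed by $c_Y(A(\theta)_x)$. An object $x$ of a bicategory is *biinitial* if for every object $y$ there is a 1-cell $x\to y$, between any two parallel 1-cells $x\to y$ there is a 2-cell, and any two parallel 2-cells between such 1-cells are equal. **Formal morphisms.** Let $G_0$ be the W-type of the container (shapes and positions) of $A$, with algebra map $c_0:A(G_0)\to G_0$. *Formal morphisms* $x\sim_P y$, for all codes $P$ and $x,y\in P(G_0)$ simultaneously, are inductively generated by identities, inverses, composites; $\mathsf{inl}(f)$, $\mathsf{inr}(f)$, pairs $\langle f,g\rangle$; $\mathsf{path}(j,x):l_j(x)\sim_{\mathsf{Id}}r_j(x)$ for $j\in J$, $x\in Q_j(G_0)$; $\mathsf{ap}(f):c_0(x)\sim_{\mathsf{Id}}c_0(y)$ for $f:x\sim_A y$; and $\mathsf{const}(k):x\sim_{\mathsf C(i)}y$ for morphisms $k:x\to y$ of $K_i$. Endpoints act on formal morphisms, and a homotopy endpoint $h:s\Rightarrow t$ sends $x\in R(G_0)$ and a formal morphism $w:a(x)\sim_T b(x)$ to a formal morphism $h(x,w):s(x)\sim_W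 t(x)$. The relation $f\approx_P g$ on parallel formal morphisms $x\sim_P y$ is the inductively generated family whose rules are: reflexivity, symmetry, transitivity; the groupoid laws; compatibility with inverses, composition, $\mathsf{ap}$, $\mathsf{inl}$, $\mathsf{inr}$ and pairing; preservation of identities and composites by $\mathsf{ap}$, $\mathsf{inl}$, $\mathsf{inr}$, pairing and $\mathsf{const}$; $\lambda_k(x,w)\approx\rho_k(x,w)$ for all $k\in H$, $x\in R_k(G_0)$ and $w:a_k(x)\sim_{T_k}b_k(x)$; and, for every $f:x\sim_{Q_j}y$, that $\mathsf{path}(j,x)$ followed by $r_j(f)$ is $\approx$-related to $l_j(f)$ followed by $\mathsf{path}(j,y)$. Let $\approx^p$ be its propositional truncation. **Theorem.** For every signature $\Sigma$ there is a biinitial object $G$ in the bicategory of groupoid algebras for $\Sigma$ such that: * the objects of $G$ form the W-type $G_0$; * the set of morphisms $x\to y$ of $G$ is the set quotient of the formal morphisms $x\sim_{\mathsf{Id}}y$ by $\approx^p$, with identities, composition and inverses induced by the formal ones; * the point operation of $G$ is $c_0$ on objects, and sends the morphism of $A(G)$ denoted by a formal morphism $f:x\sim_A y$ to the class of $\mathsf{ap}(f)$;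 * the path operation $p_j$ of $G$ at $x\in Q_j(G_0)$ is the class of $\mathsf{path}(j,x)$. -/

import Mathlib

open CategoryTheory

universe u

set_option linter.unusedSectionVars false

namespace GrpdHIT

/-! ## Polynomial codes

The 1-types that serve as constants are given as a small family `K` of groupoids (points, paths and
functions of 1-types are the objects, morphisms and functors of groupoids). A 1-type that is a set
is a discrete groupoid. -/

/-- Codes for finitary polynomials, with constants indexed by `ι`. -/
inductive Code (ι : Type u) : Type u
  | const (i : ι) : Code ι
  | id : Code ι
  | sum (P Q : Code ι) : Code ι
  | prod (P Q : Code ι) : Code ι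

/-- The disjoint union of two groupoids (on top of the disjoint union of categories). -/
instance sumGroupoid (C D : Type u) [Groupoid.{u} C] [Groupoid.{u} D] : Groupoid.{u} (C ⊕ D) where
  inv {x y} f :=
    match x, y, f with
    | Sum.inl _, Sum.inl _, f => ULift.up (Groupoid.inv f.down)
    | Sum.inr _, Sum.inr _, f => ULift.up (Groupoid.inv f.down)
  inv_comp {x y} f :=
    match x, y, f with
    | Sum.inl _, Sum.inl _, f => congrArg ULift.up (Groupoid.inv_comp f.down)
    | Sum.inr _, Sum.inr _, f => congrArg ULift.up (Groupoid.inv_comp f.down)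
  comp_inv {x y} f :=
    match x, y, f with
    | Sum.inl _, Sum.inl _, f => congrArg ULift.up (Groupoid.comp_inv f.down)
    | Sum.inr _, Sum.inr _, f => congrArg ULift.up (Groupoid.comp_inv f.down)

/-- The product of two groupoids (on top of the product of categories). -/
instance prodGroupoid (C D : Type u) [Groupoid.{u} C] [Groupoid.{u} D] : Groupoid.{u} (C × D) where
  inv f := (Groupoid.inv f.1, Groupoid.inv f.2)
  inv_comp f := Prod.ext (Groupoid.inv_comp f.1) (Groupoid.inv_comp f.2)
  comp_inv f := Prod.ext (Groupoid.comp_inv f.1) (Groupoid.comp_inv f.2)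

namespace Code

variable {ι : Type u} (K : ι → Grpd.{u, u})

/-- The type `P(X)`. -/
def Obj : Code ι → Type u → Type u
  | const i, _ => K i
  | id, X => X
  | sum P Q, X => P.Obj X ⊕ Q.Obj X
  | prod P Q, X => P.Obj X × Q.Obj X

/-- The groupoid `P(G)`: constant, identity, disjoint union, product. -/
instance groupoid : (P : Code ι) → (G : Type u) → [Groupoid.{u} G] → Groupoid.{u} (P.Obj K G)
  | const i, _, _ => (K i).str
  | id, _, inst => inst
  | sum P Q, G, _ =>
    letI := groupoid P G
    letI := groupoid Q G
    sumGroupoid (P.Obj K G) (Q.Obj K G)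
  | prod P Q, G, _ =>
    letI := groupoid P G
    letI := groupoid Q G
    prodGroupoid (P.Obj K G) (Q.Obj K G)

/-- The action of `P` on functions. -/
def mapObj : (P : Code ι) → {X Y : Type u} → (X → Y) → P.Obj K X → P.Obj K Y
  | const _, _, _, _ => fun x => x
  | id, _, _, F => F
  | sum P Q, _, _, F => Sum.map (P.mapObj F) (Q.mapObj F)
  | prod P Q, _, _, F => Prod.map (P.mapObj F) (Q.mapObj F)

section Groupoids

variable {X Y Z T : Type u} [Groupoid.{u} X] [Groupoid.{u} Y] [Groupoid.{u} Z] [Groupoid.{u} T]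

/-- The action of `P` on a functor, on morphisms. -/
def mapHom : (P : Code ι) → (F : X ⥤ Y) → {x y : P.Obj K X} → (x ⟶ y) →
    (P.mapObj K F.obj x ⟶ P.mapObj K F.obj y)
  | const _, _, _, _, f => f
  | id, F, _, _, f => F.map f
  | sum P _, F, Sum.inl _, Sum.inl _, f => ULift.up (P.mapHom F f.down)
  | sum _ Q, F, Sum.inr _, Sum.inr _, f => ULift.up (Q.mapHom F f.down)
  | prod P Q, F, _, _, f => (P.mapHom F f.1, Q.mapHom F f.2)

theorem mapHom_id (P : Code ι) (F : X ⥤ Y) (x : P.Obj K X) :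
    P.mapHom K F (𝟙 x) = 𝟙 (P.mapObj K F.obj x) := by
  induction P with
  | const i => rfl
  | id => exact F.map_id x
  | sum P Q ihP ihQ =>
    cases x with
    | inl x => exact congrArg ULift.up (ihP x)
    | inr x => exact congrArg ULift.up (ihQ x)
  | prod P Q ihP ihQ => exact Prod.ext (ihP x.1) (ihQ x.2)

theorem mapHom_comp (P : Code ι) (F : X ⥤ Y) {x y z : P.Obj K X} (f : x ⟶ y) (g : y ⟶ z) :
    P.mapHom K F (f ≫ g) = P.mapHom K F f ≫ P.mapHom K F g := by
  induction P with
  | const i => rfl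
  | id => exact F.map_comp f g
  | sum P Q ihP ihQ =>
    match x, y, z, f, g with
    | Sum.inl _, Sum.inl _, Sum.inl _, f, g => exact congrArg ULift.up (ihP f.down g.down)
    | Sum.inr _, Sum.inr _, Sum.inr _, f, g => exact congrArg ULift.up (ihQ f.down g.down)
  | prod P Q ihP ihQ => exact Prod.ext (ihP f.1 g.1) (ihQ f.2 g.2)

/-- The action of `P` on functors: `P(F) : P(X) ⥤ P(Y)`. -/
def functor (P : Code ι) (F : X ⥤ Y) : P.Obj K X ⥤ P.Obj K Y where
  obj := P.mapObj K F.obj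
  map := P.mapHom K F
  map_id := P.mapHom_id K F
  map_comp := P.mapHom_comp K F

/-- The action of `P` on (the components of) natural transformations. -/
def mapTrans : (P : Code ι) → {F G : X → Y} → (∀ x, F x ⟶ G x) → (x : P.Obj K X) →
    (P.mapObj K F x ⟶ P.mapObj K G x)
  | const i, _, _, _, x => @CategoryStruct.id (K i) _ x
  | id, _, _, θ, x => θ x
  | sum P _, _, _, θ, Sum.inl x => ULift.up (P.mapTrans θ x)
  | sum _ Q, _, _, θ, Sum.inr x => ULift.up (Q.mapTrans θ x)
  | prod P Q, _, _, θ, x => (P.mapTrans θ x.1, Q.mapTrans θ x.2)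

/-- The identitor `x ⟶ P(id)(x)`. -/
def idTor : (P : Code ι) → (x : P.Obj K X) → (x ⟶ P.mapObj K (fun z : X => z) x)
  | const i, x => @CategoryStruct.id (K i) _ x
  | id, x => @CategoryStruct.id (X) _ x
  | sum P _, Sum.inl x => ULift.up (P.idTor x)
  | sum _ Q, Sum.inr x => ULift.up (Q.idTor x)
  | prod P Q, x => (P.idTor x.1, Q.idTor x.2)

/-- The compositor `P(G)(P(F)(x)) ⟶ P(F ⋙ G)(x)`. -/
def compTor {X Y : Type u} : (P : Code ι) → (F : X → Y) → (G : Y → Z) → (x : P.Obj K X) →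
    (P.mapObj K G (P.mapObj K F x) ⟶ P.mapObj K (fun z => G (F z)) x)
  | const i, _, _, x => @CategoryStruct.id (K i) _ x
  | id, F, G, x => @CategoryStruct.id (Z) _ (G (F x))
  | sum P _, F, G, Sum.inl x => ULift.up (P.compTor F G x)
  | sum _ Q, F, G, Sum.inr x => ULift.up (Q.compTor F G x)
  | prod P Q, F, G, x => (P.compTor F G x.1, Q.compTor F G x.2)

theorem mapTrans_id (P : Code ι) (F : X → Y) (x : P.Obj K X) :
    P.mapTrans K (fun z => 𝟙 (F z)) x = 𝟙 (P.mapObj K F x) := by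
  induction P with
  | const i => rfl
  | id => rfl
  | sum P Q ihP ihQ =>
    cases x with
    | inl x => exact congrArg ULift.up (ihP x)
    | inr x => exact congrArg ULift.up (ihQ x)
  | prod P Q ihP ihQ => exact Prod.ext (ihP x.1) (ihQ x.2)

theorem mapTrans_comp (P : Code ι) {F G H : X → Y} (θ : ∀ x, F x ⟶ G x) (η : ∀ x, G x ⟶ H x)
    (x : P.Obj K X) :
    P.mapTrans K (fun z => θ z ≫ η z) x = P.mapTrans K θ x ≫ P.mapTrans K η x := by
  induction P with
  | const i => exact (Category.comp_id (obj := K i) _).symm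
  | id => rfl
  | sum P Q ihP ihQ =>
    cases x with
    | inl x => exact congrArg ULift.up (ihP x)
    | inr x => exact congrArg ULift.up (ihQ x)
  | prod P Q ihP ihQ => exact Prod.ext (ihP x.1) (ihQ x.2)

theorem mapTrans_natural (P : Code ι) {F G : X ⥤ Y} (θ : F ⟶ G) {x y : P.Obj K X} (f : x ⟶ y) :
    P.mapHom K F f ≫ P.mapTrans K θ.app y = P.mapTrans K θ.app x ≫ P.mapHom K G f := by
  induction P with
  | const i => exact (Category.comp_id (obj := K i) _).trans (Category.id_comp (obj := K i) _).symm
  | id => exact θ.naturality f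
  | sum P Q ihP ihQ =>
    match x, y, f with
    | Sum.inl _, Sum.inl _, f => exact congrArg ULift.up (ihP f.down)
    | Sum.inr _, Sum.inr _, f => exact congrArg ULift.up (ihQ f.down)
  | prod P Q ihP ihQ => exact Prod.ext (ihP f.1) (ihQ f.2)

theorem idTor_natural (P : Code ι) {x y : P.Obj K X} (f : x ⟶ y) :
    f ≫ P.idTor K y = P.idTor K x ≫ P.mapHom K (𝟭 X) f := by
  induction P with
  | const i => exact (Category.comp_id (obj := K i) _).trans (Category.id_comp (obj := K i) _).symm
  | id => exact (Category.comp_id (obj := X) _).trans (Category.id_comp (obj := X) _).symm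
  | sum P Q ihP ihQ =>
    match x, y, f with
    | Sum.inl _, Sum.inl _, f => exact congrArg ULift.up (ihP f.down)
    | Sum.inr _, Sum.inr _, f => exact congrArg ULift.up (ihQ f.down)
  | prod P Q ihP ihQ => exact Prod.ext (ihP f.1) (ihQ f.2)

theorem compTor_natural (P : Code ι) (F : X ⥤ Y) (G : Y ⥤ Z) {x y : P.Obj K X} (f : x ⟶ y) :
    P.mapHom K G (P.mapHom K F f) ≫ P.compTor K F.obj G.obj y =
      P.compTor K F.obj G.obj x ≫ P.mapHom K (F ⋙ G) f := by
  induction P with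
  | const i => exact (Category.comp_id (obj := K i) _).trans (Category.id_comp (obj := K i) _).symm
  | id => exact (Category.comp_id (obj := Z) _).trans (Category.id_comp (obj := Z) _).symm
  | sum P Q ihP ihQ =>
    match x, y, f with
    | Sum.inl _, Sum.inl _, f => exact congrArg ULift.up (ihP f.down)
    | Sum.inr _, Sum.inr _, f => exact congrArg ULift.up (ihQ f.down)
  | prod P Q ihP ihQ => exact Prod.ext (ihP f.1) (ihQ f.2)

theorem compTor_whiskerLeft (P : Code ι) (F : X → Y) {G H : Y → Z} (θ : ∀ y, G y ⟶ H y)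
    (x : P.Obj K X) :
    P.mapTrans K θ (P.mapObj K F x) ≫ P.compTor K F H x =
      P.compTor K F G x ≫ P.mapTrans K (fun z => θ (F z)) x := by
  induction P with
  | const i => rfl
  | id => exact (Category.comp_id (obj := Z) _).trans (Category.id_comp (obj := Z) _).symm
  | sum P Q ihP ihQ =>
    cases x with
    | inl x => exact congrArg ULift.up (ihP x)
    | inr x => exact congrArg ULift.up (ihQ x)
  | prod P Q ihP ihQ => exact Prod.ext (ihP x.1) (ihQ x.2)

theorem compTor_whiskerRight (P : Code ι) {F G : X → Y} (θ : ∀ x, F x ⟶ G x) (H : Y ⥤ Z)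
    (x : P.Obj K X) :
    P.mapHom K H (P.mapTrans K θ x) ≫ P.compTor K G H.obj x =
      P.compTor K F H.obj x ≫ P.mapTrans K (fun z => H.map (θ z)) x := by
  induction P with
  | const i => rfl
  | id => exact (Category.comp_id (obj := Z) _).trans (Category.id_comp (obj := Z) _).symm
  | sum P Q ihP ihQ =>
    cases x with
    | inl x => exact congrArg ULift.up (ihP x)
    | inr x => exact congrArg ULift.up (ihQ x)
  | prod P Q ihP ihQ => exact Prod.ext (ihP x.1) (ihQ x.2)

theorem compTor_assoc {X Y : Type u} (P : Code ι) (F : X → Y) (G : Y → Z) (H : Z ⥤ T)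
    (x : P.Obj K X) :
    P.mapHom K H (P.compTor K F G x) ≫ P.compTor K (fun z => G (F z)) H.obj x =
      P.compTor K G H.obj (P.mapObj K F x) ≫ P.compTor K F (fun z => H.obj (G z)) x := by
  induction P with
  | const i => rfl
  | id =>
    exact congrArg (fun t => t ≫ 𝟙 (H.obj (G (F x)))) (H.map_id _)
  | sum P Q ihP ihQ =>
    cases x with
    | inl x => exact congrArg ULift.up (ihP x)
    | inr x => exact congrArg ULift.up (ihQ x)
  | prod P Q ihP ihQ => exact Prod.ext (ihP x.1) (ihQ x.2)

theorem idTor_compTor_left (P : Code ι) (F : X ⥤ Y) (x : P.Obj K X) :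
    P.mapHom K F (P.idTor K x) ≫ P.compTor K (fun z : X => z) F.obj x =
      𝟙 (P.mapObj K F.obj x) := by
  induction P with
  | const i => exact Category.comp_id (obj := K i) _
  | id => exact (Category.comp_id (obj := Y) _).trans (F.map_id x)
  | sum P Q ihP ihQ =>
    cases x with
    | inl x => exact congrArg ULift.up (ihP x)
    | inr x => exact congrArg ULift.up (ihQ x)
  | prod P Q ihP ihQ => exact Prod.ext (ihP x.1) (ihQ x.2)

theorem idTor_compTor_right {X : Type u} (P : Code ι) (F : X → Y) (x : P.Obj K X) :
    P.idTor K (P.mapObj K F x) ≫ P.compTor K F (fun z : Y => z) x = 𝟙 (P.mapObj K F x) := by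
  induction P with
  | const i => exact Category.comp_id (obj := K i) _
  | id => exact Category.comp_id (obj := Y) _
  | sum P Q ihP ihQ =>
    cases x with
    | inl x => exact congrArg ULift.up (ihP x)
    | inr x => exact congrArg ULift.up (ihQ x)
  | prod P Q ihP ihQ => exact Prod.ext (ihP x.1) (ihQ x.2)

end Groupoids

/-- The container (shapes and positions) of a polynomial code. -/
def container : Code ι → PFunctor.{u, u}
  | const i => ⟨K i, fun _ => PEmpty⟩
  | id => ⟨PUnit, fun _ => PUnit⟩
  | sum P Q => ⟨P.container.A ⊕ Q.container.A, Sum.elim P.container.B Q.container.B⟩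
  | prod P Q => ⟨P.container.A × Q.container.A, fun s => P.container.B s.1 ⊕ Q.container.B s.2⟩

/-- The container of `P` represents `P`: one direction of the bijection. -/
def toContainer : (P : Code ι) → {X : Type u} → P.Obj K X → (P.container K) X
  | const _, _, x => ⟨x, fun e => e.elim⟩
  | id, _, x => ⟨PUnit.unit, fun _ => x⟩
  | sum P _, _, Sum.inl x => ⟨Sum.inl (P.toContainer x).1, (P.toContainer x).2⟩
  | sum _ Q, _, Sum.inr x => ⟨Sum.inr (Q.toContainer x).1, (Q.toContainer x).2⟩
  | prod P Q, _, x =>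
    ⟨((P.toContainer x.1).1, (Q.toContainer x.2).1),
      Sum.elim (P.toContainer x.1).2 (Q.toContainer x.2).2⟩

theorem toContainer_bijective (P : Code ι) (X : Type u) :
    Function.Bijective (P.toContainer K (X := X)) := by
  induction P with
  | const i =>
    refine ⟨fun x y h => congrArg Sigma.fst h, fun ⟨s, v⟩ => ⟨s, ?_⟩⟩
    exact Sigma.ext rfl (heq_of_eq (funext fun e => e.elim))
  | id =>
    refine ⟨fun x y h => ?_, fun ⟨s, v⟩ => ⟨v PUnit.unit, rfl⟩⟩
    have h' : (fun _ : PUnit => x) = (fun _ : PUnit => y) := eq_of_heq (Sigma.mk.inj h).2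
    exact congrFun h' PUnit.unit
  | sum P Q ihP ihQ =>
    constructor
    · rintro (x | x) (y | y) h
      · obtain ⟨h1, h2⟩ := Sigma.mk.inj h
        exact congrArg Sum.inl (ihP.1 (Sigma.ext (Sum.inl.inj h1) h2))
      · exact nomatch (Sigma.mk.inj h).1
      · exact nomatch (Sigma.mk.inj h).1
      · obtain ⟨h1, h2⟩ := Sigma.mk.inj h
        exact congrArg Sum.inr (ihQ.1 (Sigma.ext (Sum.inr.inj h1) h2))
    · rintro ⟨s | s, v⟩
      · obtain ⟨x, hx⟩ := ihP.2 ⟨s, v⟩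
        refine ⟨Sum.inl x, ?_⟩
        change (⟨Sum.inl (P.toContainer K x).1, (P.toContainer K x).2⟩ :
          ((Code.sum P Q).container K) X) = _
        rw [hx]
      · obtain ⟨x, hx⟩ := ihQ.2 ⟨s, v⟩
        refine ⟨Sum.inr x, ?_⟩
        change (⟨Sum.inr (Q.toContainer K x).1, (Q.toContainer K x).2⟩ :
          ((Code.sum P Q).container K) X) = _
        rw [hx]
  | prod P Q ihP ihQ =>
    constructor
    · rintro ⟨x, w⟩ ⟨y, z⟩ h
      change (⟨((P.toContainer K x).1, (Q.toContainer K w).1),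
          Sum.elim (P.toContainer K x).2 (Q.toContainer K w).2⟩ :
          ((Code.prod P Q).container K) X) =
        ⟨((P.toContainer K y).1, (Q.toContainer K z).1),
          Sum.elim (P.toContainer K y).2 (Q.toContainer K z).2⟩ at h
      have key : ∀ a b : (P.container K) X, ∀ c d : (Q.container K) X,
          (⟨(a.1, c.1), Sum.elim a.2 c.2⟩ : ((Code.prod P Q).container K) X) =
            ⟨(b.1, d.1), Sum.elim b.2 d.2⟩ → a = b ∧ c = d := by
        rintro ⟨a, a'⟩ ⟨b, b'⟩ ⟨c, c'⟩ ⟨d, d'⟩ e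
        obtain ⟨e1, e2⟩ := Sigma.mk.inj e
        obtain ⟨rfl, rfl⟩ := Prod.mk.inj e1
        have e3 := eq_of_heq e2
        exact ⟨Sigma.ext rfl (heq_of_eq (funext fun i => congrFun e3 (Sum.inl i))),
          Sigma.ext rfl (heq_of_eq (funext fun i => congrFun e3 (Sum.inr i)))⟩
      obtain ⟨h1, h2⟩ := key _ _ _ _ h
      exact Prod.ext (ihP.1 h1) (ihQ.1 h2)
    · rintro ⟨⟨s, t⟩, v⟩
      obtain ⟨x, hx⟩ := ihP.2 ⟨s, fun i => v (Sum.inl i)⟩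
      obtain ⟨y, hy⟩ := ihQ.2 ⟨t, fun i => v (Sum.inr i)⟩
      refine ⟨(x, y), ?_⟩
      change (⟨((P.toContainer K x).1, (Q.toContainer K y).1),
          Sum.elim (P.toContainer K x).2 (Q.toContainer K y).2⟩ :
          ((Code.prod P Q).container K) X) = _
      rw [hx, hy]
      refine Sigma.ext rfl (heq_of_eq (funext ?_))
      rintro (i | i) <;> rfl

end Code

/-! ## Auxiliary pasting lemmas -/

section Pasting

variable {C : Type u} [Category.{u} C] {x₁ x₂ x₃ x₄ x₅ x₆ x₇ x₈ : C}

theorem paste₁ {i : x₁ ⟶ x₂} {a : x₂ ⟶ x₃} {m : x₁ ⟶ x₃} {c : x₃ ⟶ x₄} {n : x₁ ⟶ x₄}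
    (h₁ : i ≫ a = m) (h₂ : m ≫ c = n) : i ≫ (a ≫ c) = n := by
  rw [← Category.assoc, h₁, h₂]

theorem paste₂ {a : x₁ ⟶ x₂} {b : x₂ ⟶ x₃} {d : x₁ ⟶ x₄} {k : x₄ ⟶ x₃} {c : x₃ ⟶ x₅}
    {e : x₄ ⟶ x₆} {g : x₆ ⟶ x₅} (h₁ : a ≫ b = d ≫ k) (h₂ : k ≫ c = e ≫ g) :
    a ≫ (b ≫ c) = (d ≫ e) ≫ g := by
  rw [← Category.assoc, h₁, Category.assoc, h₂, Category.assoc]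

theorem paste₃ {a : x₁ ⟶ x₂} {u : x₂ ⟶ x₃} {g₁ : x₁ ⟶ x₄} {v : x₄ ⟶ x₅} {w : x₅ ⟶ x₃}
    {u' : x₃ ⟶ x₆} {q : x₅ ⟶ x₇} {v' : x₇ ⟶ x₈} {w' : x₈ ⟶ x₆} {y : C} {g₂ : x₄ ⟶ y}
    {v'' : y ⟶ x₇} {g : x₁ ⟶ y} (h₁ : a ≫ u = g₁ ≫ v ≫ w) (h₂ : w ≫ u' = q ≫ v' ≫ w')
    (h₃ : g₂ ≫ v'' = v ≫ q) (h₄ : g = g₁ ≫ g₂) : a ≫ (u ≫ u') = g ≫ (v'' ≫ v') ≫ w' := by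
  rw [← Category.assoc, h₁, h₄]
  simp only [Category.assoc]
  rw [h₂, ← Category.assoc v, ← h₃]
  simp only [Category.assoc]

theorem paste₄ {f₁ : x₁ ⟶ x₂} {a : x₁ ⟶ x₃} {a' : x₂ ⟶ x₄} {f₂ : x₃ ⟶ x₄} {b : x₃ ⟶ x₅}
    {b' : x₄ ⟶ x₆} {f₃ : x₅ ⟶ x₆} {c : x₅ ⟶ x₇} {c' : x₆ ⟶ x₈} {f₄ : x₇ ⟶ x₈}
    (h₁ : f₁ ≫ a' = a ≫ f₂) (h₂ : f₂ ≫ b' = b ≫ f₃) (h₃ : f₃ ≫ c' = c ≫ f₄) :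
    f₁ ≫ (a' ≫ b' ≫ c') = (a ≫ b ≫ c) ≫ f₄ := by
  rw [← Category.assoc, h₁, Category.assoc, ← Category.assoc f₂, h₂, Category.assoc, h₃]
  simp only [Category.assoc]

theorem paste₅ {f₁ : x₁ ⟶ x₂} {a : x₁ ⟶ x₃} {a' : x₂ ⟶ x₄} {f₂ : x₃ ⟶ x₄} {b : x₃ ⟶ x₅}
    {b' : x₄ ⟶ x₆} {f₃ : x₅ ⟶ x₆} {c : x₅ ⟶ x₇} {c' : x₆ ⟶ x₈} {f₄ : x₇ ⟶ x₈}
    {l : x₁ ⟶ x₇} {r : x₂ ⟶ x₈}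
    (h₁ : f₁ ≫ a' = a ≫ f₂) (h₂ : f₂ ≫ b' = b ≫ f₃) (h₃ : c ≫ f₄ = f₃ ≫ c')
    (hl : 𝟙 _ ≫ l = a ≫ b ≫ c) (hr : 𝟙 _ ≫ r = a' ≫ b' ≫ c') : f₁ ≫ r = l ≫ f₄ := by
  rw [← Category.id_comp r, ← Category.id_comp l, hl, hr]
  exact paste₄ h₁ h₂ h₃.symm

theorem paste₆ {a : x₁ ⟶ x₂} {b : x₂ ⟶ x₃} {p : x₁ ⟶ x₄} {q : x₂ ⟶ x₅} {r : x₃ ⟶ x₆}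
    {a' : x₄ ⟶ x₅} {b' : x₅ ⟶ x₆} {k : x₄ ⟶ x₆}
    (h₁ : a ≫ q = p ≫ a') (h₂ : b ≫ r = q ≫ b') (h₃ : k = a' ≫ b') :
    (a ≫ b) ≫ r = p ≫ k := by
  rw [h₃, Category.assoc, h₂, ← Category.assoc, h₁, Category.assoc]

theorem paste₇ {p : x₁ ⟶ x₂} {q : x₂ ⟶ x₃} {r : x₃ ⟶ x₄} {m : x₁ ⟶ x₄} {s : x₄ ⟶ x₅}
    {t : x₅ ⟶ x₆} {s' : x₃ ⟶ x₇} {r' : x₇ ⟶ x₅} {t' : x₇ ⟶ x₈} {t'' : x₈ ⟶ x₆}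
    (h₁ : m = p ≫ q ≫ r) (h₂ : r ≫ s = s' ≫ r') (h₃ : r' ≫ t = t' ≫ t'') :
    m ≫ s ≫ t = p ≫ (q ≫ s' ≫ t') ≫ t'' := by
  rw [h₁]
  simp only [Category.assoc]
  rw [← Category.assoc r, h₂, Category.assoc, h₃]

end Pasting

/-! ## Path endpoints -/

variable {ι : Type u}

/-- Path endpoints with arguments `A`, source and target. -/
inductive Endpoint (K : ι → Grpd.{u, u}) (A : Code ι) : Code ι → Code ι → Type u
  | id (P : Code ι) : Endpoint K A P P
  | comp {P Q R : Code ι} (e₁ : Endpoint K A P Q) (e₂ : Endpoint K A Q R) : Endpoint K A P R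
  | constr : Endpoint K A A Code.id
  | inl (P Q : Code ι) : Endpoint K A P (Code.sum P Q)
  | inr (P Q : Code ι) : Endpoint K A Q (Code.sum P Q)
  | fst (P Q : Code ι) : Endpoint K A (Code.prod P Q) P
  | snd (P Q : Code ι) : Endpoint K A (Code.prod P Q) Q
  | pair {P Q R : Code ι} (e₁ : Endpoint K A P Q) (e₂ : Endpoint K A P R) :
      Endpoint K A P (Code.prod Q R)
  | const (P : Code ι) {i : ι} (x : K i) : Endpoint K A P (Code.const i)
  | fmap {i j : ι} (F : K i ⥤ K j) : Endpoint K A (Code.const i) (Code.const j)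

namespace Endpoint

variable {K : ι → Grpd.{u, u}} {A : Code ι}

/-- The interpretation of an endpoint as a function `P(X) → Q(X)`, given `c : A(X) → X`. -/
def obj {X : Type u} (c : A.Obj K X → X) : {P Q : Code ι} → Endpoint K A P Q →
    P.Obj K X → Q.Obj K X
  | _, _, id _ => fun x => x
  | _, _, comp e₁ e₂ => fun x => e₂.obj c (e₁.obj c x)
  | _, _, constr => c
  | _, _, inl _ _ => Sum.inl
  | _, _, inr _ _ => Sum.inr
  | _, _, fst _ _ => Prod.fst
  | _, _, snd _ _ => Prod.snd
  | _, _, pair e₁ e₂ => fun x => (e₁.obj c x, e₂.obj c x)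
  | _, _, const _ x => fun _ => x
  | _, _, fmap F => F.obj

section Groupoids

variable {X Y Z : Type u} [Groupoid.{u} X] [Groupoid.{u} Y] [Groupoid.{u} Z]

/-- The interpretation of an endpoint on morphisms of `P(X)`, given a functor `c : A(X) ⥤ X`. -/
def map (c : A.Obj K X ⥤ X) : {P Q : Code ι} → (e : Endpoint K A P Q) → {x y : P.Obj K X} →
    (x ⟶ y) → (e.obj c.obj x ⟶ e.obj c.obj y)
  | _, _, id _, _, _, f => f
  | _, _, comp e₁ e₂, _, _, f => e₂.map c (e₁.map c f)
  | _, _, constr, _, _, f => c.map f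
  | _, _, inl _ _, _, _, f => ULift.up f
  | _, _, inr _ _, _, _, f => ULift.up f
  | _, _, fst _ _, _, _, f => f.1
  | _, _, snd _ _, _, _, f => f.2
  | _, _, pair e₁ e₂, _, _, f => (e₁.map c f, e₂.map c f)
  | _, _, const (i := i) _ x, _, _, _ => @CategoryStruct.id (K i) _ x
  | _, _, fmap F, _, _, f => F.map f

theorem map_id (c : A.Obj K X ⥤ X) {P Q : Code ι} (e : Endpoint K A P Q) (x : P.Obj K X) :
    e.map c (𝟙 x) = 𝟙 (e.obj c.obj x) := by
  induction e with
  | id P => rfl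
  | comp e₁ e₂ ih₁ ih₂ => exact (congrArg (e₂.map c) (ih₁ x)).trans (ih₂ _)
  | constr => exact c.map_id x
  | inl P Q => rfl
  | inr P Q => rfl
  | fst P Q => rfl
  | snd P Q => rfl
  | pair e₁ e₂ ih₁ ih₂ => exact Prod.ext (ih₁ x) (ih₂ x)
  | const P x => rfl
  | fmap F => exact F.map_id x

theorem map_comp (c : A.Obj K X ⥤ X) {P Q : Code ι} (e : Endpoint K A P Q) {x y z : P.Obj K X}
    (f : x ⟶ y) (g : y ⟶ z) : e.map c (f ≫ g) = e.map c f ≫ e.map c g := by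
  induction e with
  | id P => rfl
  | comp e₁ e₂ ih₁ ih₂ => exact (congrArg (e₂.map c) (ih₁ f g)).trans (ih₂ _ _)
  | constr => exact c.map_comp f g
  | inl P Q => rfl
  | inr P Q => rfl
  | fst P Q => rfl
  | snd P Q => rfl
  | pair e₁ e₂ ih₁ ih₂ => exact Prod.ext (ih₁ f g) (ih₂ f g)
  | const P x => exact (Category.comp_id (obj := K _) _).symm
  | fmap F => exact F.map_comp f g

/-- The interpretation of an endpoint as a functor `P(X) ⥤ Q(X)`. -/
def functor (c : A.Obj K X ⥤ X) {P Q : Code ι} (e : Endpoint K A P Q) :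
    P.Obj K X ⥤ Q.Obj K X where
  obj := e.obj c.obj
  map := e.map c
  map_id := e.map_id c
  map_comp := e.map_comp c

/-- The pseudonaturality cell `Q(F)(e(x)) ⟶ e(P(F)(x))` of an endpoint `e`, with respect to a
map `F` that commutes with the point operations up to the cells `τ`. -/
def cell {c : A.Obj K X → X} (d : A.Obj K Y ⥤ Y) (F : X → Y)
    (τ : ∀ x, F (c x) ⟶ d.obj (A.mapObj K F x)) : {P Q : Code ι} → (e : Endpoint K A P Q) →
    (x : P.Obj K X) → (Q.mapObj K F (e.obj c x) ⟶ e.obj d.obj (P.mapObj K F x))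
  | _, _, id _, _ => 𝟙 _
  | _, _, comp e₁ e₂, x => e₂.cell d F τ (e₁.obj c x) ≫ e₂.map d (e₁.cell d F τ x)
  | _, _, constr, x => τ x
  | _, _, inl _ _, _ => 𝟙 _
  | _, _, inr _ _, _ => 𝟙 _
  | _, _, fst _ _, _ => 𝟙 _
  | _, _, snd _ _, _ => 𝟙 _
  | _, _, pair e₁ e₂, x => (e₁.cell d F τ x, e₂.cell d F τ x)
  | _, _, const _ _, _ => 𝟙 _
  | _, _, fmap _, _ => 𝟙 _

theorem cell_natural {c : A.Obj K X ⥤ X} (d : A.Obj K Y ⥤ Y) (F : X ⥤ Y)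
    (τ : c ⋙ F ⟶ A.functor K F ⋙ d) {P Q : Code ι} (e : Endpoint K A P Q)
    {x y : P.Obj K X} (f : x ⟶ y) :
    Q.mapHom K F (e.map c f) ≫ e.cell d F.obj τ.app y =
      e.cell d F.obj τ.app x ≫ e.map d (P.mapHom K F f) := by
  induction e with
  | id P => exact (Category.comp_id _).trans (Category.id_comp _).symm
  | comp e₁ e₂ ih₁ ih₂ =>
    have h := congrArg (e₂.map d) (ih₁ f)
    rw [map_comp, map_comp] at h
    exact paste₂ (ih₂ (e₁.map c f)) h
  | constr => exact τ.naturality f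
  | inl P Q => exact (Category.comp_id _).trans (Category.id_comp _).symm
  | inr P Q => exact (Category.comp_id _).trans (Category.id_comp _).symm
  | fst P Q => exact (Category.comp_id _).trans (Category.id_comp _).symm
  | snd P Q => exact (Category.comp_id _).trans (Category.id_comp _).symm
  | pair e₁ e₂ ih₁ ih₂ => exact Prod.ext (ih₁ f) (ih₂ f)
  | const P x => exact (Category.comp_id _).trans (Category.id_comp _).symm
  | fmap F => exact (Category.comp_id _).trans (Category.id_comp _).symm

theorem cell_id (c : A.Obj K X ⥤ X) {P Q : Code ι} (e : Endpoint K A P Q) (x : P.Obj K X) :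
    Q.idTor K (e.obj c.obj x) ≫
        e.cell c (fun z => z) (fun z => c.map (A.idTor K z)) x =
      e.map c (P.idTor K x) := by
  induction e with
  | id P => exact Category.comp_id _
  | comp e₁ e₂ ih₁ ih₂ =>
    have h := congrArg (e₂.map c) (ih₁ x)
    rw [map_comp] at h
    exact paste₁ (ih₂ (e₁.obj c.obj x)) h
  | constr => exact Category.id_comp _
  | inl P Q => exact Category.comp_id _
  | inr P Q => exact Category.comp_id _
  | fst P Q => exact Category.comp_id _
  | snd P Q => exact Category.comp_id _
  | pair e₁ e₂ ih₁ ih₂ => exact Prod.ext (ih₁ x) (ih₂ x)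
  | const P x => exact Category.comp_id _
  | fmap F => exact (Category.comp_id _).trans (F.map_id x).symm

theorem cell_comp {c : A.Obj K X ⥤ X} {d : A.Obj K Y ⥤ Y} (b : A.Obj K Z ⥤ Z)
    (F : X ⥤ Y) (G : Y ⥤ Z)
    (τ : c ⋙ F ⟶ A.functor K F ⋙ d) (σ : d ⋙ G ⟶ A.functor K G ⋙ b)
    {P Q : Code ι} (e : Endpoint K A P Q) (x : P.Obj K X) :
    Q.compTor K F.obj G.obj (e.obj c.obj x) ≫
        e.cell b (fun z => G.obj (F.obj z))
          (fun z => G.map (τ.app z) ≫ σ.app (A.mapObj K F.obj z) ≫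
            b.map (A.compTor K F.obj G.obj z)) x =
      Q.mapHom K G (e.cell d F.obj τ.app x) ≫ e.cell b G.obj σ.app (P.mapObj K F.obj x) ≫
        e.map b (P.compTor K F.obj G.obj x) := by
  induction e with
  | id P =>
    refine (Category.comp_id _).trans (Eq.symm ?_)
    refine (congrArg (· ≫ _) (P.mapHom_id K G _)).trans ?_
    exact (Category.id_comp _).trans (Category.id_comp _)
  | @comp P Q R e₁ e₂ ih₁ ih₂ =>
    have h := congrArg (e₂.map b) (ih₁ x)
    rw [map_comp, map_comp, map_comp] at h
    exact paste₃ (ih₂ (e₁.obj c.obj x)) h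
      (e₂.cell_natural b G σ (e₁.cell d F.obj τ.app x)) (R.mapHom_comp K G _ _)
  | constr => exact Category.id_comp _
  | @inl P Q =>
    refine (Category.comp_id _).trans (Eq.symm ?_)
    refine (congrArg (· ≫ _) (Code.mapHom_id K (P.sum Q) G _)).trans ?_
    exact (Category.id_comp _).trans (Category.id_comp _)
  | @inr P Q =>
    refine (Category.comp_id _).trans (Eq.symm ?_)
    refine (congrArg (· ≫ _) (Code.mapHom_id K (P.sum Q) G _)).trans ?_
    exact (Category.id_comp _).trans (Category.id_comp _)
  | fst P Q =>
    refine (Category.comp_id _).trans (Eq.symm ?_)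
    refine (congrArg (· ≫ _) (Code.mapHom_id K _ G _)).trans ?_
    exact (Category.id_comp _).trans (Category.id_comp _)
  | snd P Q =>
    refine (Category.comp_id _).trans (Eq.symm ?_)
    refine (congrArg (· ≫ _) (Code.mapHom_id K _ G _)).trans ?_
    exact (Category.id_comp _).trans (Category.id_comp _)
  | pair e₁ e₂ ih₁ ih₂ => exact Prod.ext (ih₁ x) (ih₂ x)
  | const P x => exact (Category.id_comp _).symm
  | fmap F' =>
    exact (Category.id_comp _).trans
      (((Category.id_comp _).trans ((Category.id_comp _).trans (F'.map_id _))).symm)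

end Groupoids

end Endpoint

/-! ## Homotopy endpoints and signatures -/

/-- Homotopy endpoints: formal paths `s(x) = t(x)` built from the path constructors
`l j = r j` and a path argument `a(x) = b(x)`. The last two constructors `constHom` and `fmapHom`
reflect the paths in the constant 1-types; they are trivial if the constants are sets. -/
inductive HomotEndpoint {K : ι → Grpd.{u, u}} {A : Code ι} {J : Type u} {B : J → Code ι}
    (l r : ∀ j, Endpoint K A (B j) Code.id) {R T : Code ι} (a b : Endpoint K A R T) :
    {W : Code ι} → Endpoint K A R W → Endpoint K A R W → Type u
  | refl {W : Code ι} (e : Endpoint K A R W) : HomotEndpoint l r a b e e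
  | symm {W : Code ι} {e₁ e₂ : Endpoint K A R W} (h : HomotEndpoint l r a b e₁ e₂) :
      HomotEndpoint l r a b e₂ e₁
  | trans {W : Code ι} {e₁ e₂ e₃ : Endpoint K A R W} (h₁ : HomotEndpoint l r a b e₁ e₂)
      (h₂ : HomotEndpoint l r a b e₂ e₃) : HomotEndpoint l r a b e₁ e₃
  | ap {W₁ W₂ : Code ι} {e₁ e₂ : Endpoint K A R W₁} (e : Endpoint K A W₁ W₂)
      (h : HomotEndpoint l r a b e₁ e₂) : HomotEndpoint l r a b (e₁.comp e) (e₂.comp e)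
  | assoc {W₁ W₂ W₃ : Code ι} (e₁ : Endpoint K A R W₁) (e₂ : Endpoint K A W₁ W₂)
      (e₃ : Endpoint K A W₂ W₃) :
      HomotEndpoint l r a b (e₁.comp (e₂.comp e₃)) ((e₁.comp e₂).comp e₃)
  | lunit {W : Code ι} (e : Endpoint K A R W) :
      HomotEndpoint l r a b ((Endpoint.id R).comp e) e
  | runit {W : Code ι} (e : Endpoint K A R W) :
      HomotEndpoint l r a b (e.comp (Endpoint.id W)) e
  | pairFst {W₁ W₂ : Code ι} (e₁ : Endpoint K A R W₁) (e₂ : Endpoint K A R W₂) :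
      HomotEndpoint l r a b ((e₁.pair e₂).comp (Endpoint.fst W₁ W₂)) e₁
  | pairSnd {W₁ W₂ : Code ι} (e₁ : Endpoint K A R W₁) (e₂ : Endpoint K A R W₂) :
      HomotEndpoint l r a b ((e₁.pair e₂).comp (Endpoint.snd W₁ W₂)) e₂
  | pair {W₁ W₂ : Code ι} {e₁ e₂ : Endpoint K A R W₁} {e₃ e₄ : Endpoint K A R W₂}
      (h₁ : HomotEndpoint l r a b e₁ e₂) (h₂ : HomotEndpoint l r a b e₃ e₄) :
      HomotEndpoint l r a b (e₁.pair e₃) (e₂.pair e₄)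
  | compPair {W₁ W₂ W₃ : Code ι} (e₁ : Endpoint K A R W₁) (e₂ : Endpoint K A W₁ W₂)
      (e₃ : Endpoint K A W₁ W₃) :
      HomotEndpoint l r a b (e₁.comp (e₂.pair e₃)) ((e₁.comp e₂).pair (e₁.comp e₃))
  | compConst {W : Code ι} {i : ι} (x : K i) (e : Endpoint K A R W) :
      HomotEndpoint l r a b (e.comp (Endpoint.const W x)) (Endpoint.const R x)
  | path (j : J) (e : Endpoint K A R (B j)) :
      HomotEndpoint l r a b (e.comp (l j)) (e.comp (r j))
  | arg : HomotEndpoint l r a b a b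
  | constHom {i : ι} {x y : K i} (k : x ⟶ y) :
      HomotEndpoint l r a b (Endpoint.const R x) (Endpoint.const R y)
  | fmapHom {i j : ι} {F G : K i ⥤ K j} (e : Endpoint K A R (Code.const i)) (α : F ⟶ G) :
      HomotEndpoint l r a b (e.comp (Endpoint.fmap F)) (e.comp (Endpoint.fmap G))

/-- The interpretation of a homotopy endpoint in a groupoid `X` with a point operation `c` and
path operations `p`, at an object `x` of `R(X)` and a morphism `w : a(x) ⟶ b(x)`. -/
def HomotEndpoint.interp {K : ι → Grpd.{u, u}} {A : Code ι} {J : Type u} {B : J → Code ι}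
    {l r : ∀ j, Endpoint K A (B j) Code.id} {R T : Code ι} {a b : Endpoint K A R T}
    {X : Type u} [Groupoid.{u} X] (c : A.Obj K X ⥤ X)
    (p : ∀ j, (l j).functor c ⟶ (r j).functor c) {x : R.Obj K X}
    (w : a.obj c.obj x ⟶ b.obj c.obj x) :
    {W : Code ι} → {s t : Endpoint K A R W} → HomotEndpoint l r a b s t →
    (s.obj c.obj x ⟶ t.obj c.obj x)
  | _, _, _, refl _ => 𝟙 _
  | _, _, _, symm h => Groupoid.inv (h.interp c p w)
  | _, _, _, trans h₁ h₂ => h₁.interp c p w ≫ h₂.interp c p w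
  | _, _, _, ap e h => e.map c (h.interp c p w)
  | _, _, _, assoc _ _ _ => 𝟙 _
  | _, _, _, lunit _ => 𝟙 _
  | _, _, _, runit _ => 𝟙 _
  | _, _, _, pairFst _ _ => 𝟙 _
  | _, _, _, pairSnd _ _ => 𝟙 _
  | _, _, _, pair h₁ h₂ => (h₁.interp c p w, h₂.interp c p w)
  | _, _, _, compPair _ _ _ => 𝟙 _
  | _, _, _, compConst _ _ => 𝟙 _
  | _, _, _, path j e => (p j).app (e.obj c.obj x)
  | _, _, _, arg => w
  | _, _, _, constHom k => k
  | _, _, _, fmapHom e α => α.app (e.obj c.obj x)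

/-- HIT-signatures. -/
structure HITSignature (K : ι → Grpd.{u, u}) where
  /-- the polynomial of the point constructor -/
  point : Code ι
  /-- labels of the path constructors -/
  PathLabel : Type u
  pathArg : PathLabel → Code ι
  pathLeft : ∀ j, Endpoint K point (pathArg j) Code.id
  pathRight : ∀ j, Endpoint K point (pathArg j) Code.id
  /-- labels of the homotopy constructors -/
  HomotLabel : Type u
  /-- point arguments of the homotopy constructors -/
  homotPointArg : HomotLabel → Code ι
  /-- the target of the endpoints of the path argument -/
  homotPathArg : HomotLabel → Code ι
  argLeft : ∀ j, Endpoint K point (homotPointArg j) (homotPathArg j)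
  argRight : ∀ j, Endpoint K point (homotPointArg j) (homotPathArg j)
  homotSource : ∀ j, Endpoint K point (homotPointArg j) Code.id
  homotTarget : ∀ j, Endpoint K point (homotPointArg j) Code.id
  homotLeft : ∀ j, HomotEndpoint pathLeft pathRight (argLeft j) (argRight j)
    (homotSource j) (homotTarget j)
  homotRight : ∀ j, HomotEndpoint pathLeft pathRight (argLeft j) (argRight j)
    (homotSource j) (homotTarget j)

/-! ## The bicategory of algebras in groupoids -/

/-- Algebras in groupoids for a signature. -/
structure GrpdAlgebra {K : ι → Grpd.{u, u}} (S : HITSignature K) where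
  carrier : Type u
  [grpd : Groupoid.{u} carrier]
  point : S.point.Obj K carrier ⥤ carrier
  path : ∀ j, (S.pathLeft j).functor point ⟶ (S.pathRight j).functor point
  homot : ∀ (j : S.HomotLabel) (x : (S.homotPointArg j).Obj K carrier)
    (w : (S.argLeft j).obj point.obj x ⟶ (S.argRight j).obj point.obj x),
    (S.homotLeft j).interp point path w = (S.homotRight j).interp point path w

attribute [instance] GrpdAlgebra.grpd

namespace GrpdAlgebra

variable {K : ι → Grpd.{u, u}} {S : HITSignature K}

/-- 1-cells of algebras: a functor that commutes with the point operations up to a specified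
natural transformation (automatically invertible), which is compatible with the path operations. -/
structure Hom (X Y : GrpdAlgebra S) where
  functor : X.carrier ⥤ Y.carrier
  pointCell : X.point ⋙ functor ⟶ S.point.functor K functor ⋙ Y.point
  path_comm : ∀ (j : S.PathLabel) (x : (S.pathArg j).Obj K X.carrier),
    functor.map ((X.path j).app x) ≫ (S.pathRight j).cell Y.point functor.obj pointCell.app x =
      (S.pathLeft j).cell Y.point functor.obj pointCell.app x ≫
        (Y.path j).app ((S.pathArg j).mapObj K functor.obj x)

/-- 2-cells of algebras: natural transformations compatible with the point cells. -/
@[ext]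
structure Hom₂ {X Y : GrpdAlgebra S} (f g : X.Hom Y) where
  trans : f.functor ⟶ g.functor
  point_comm : ∀ x : S.point.Obj K X.carrier,
    trans.app (X.point.obj x) ≫ g.pointCell.app x =
      f.pointCell.app x ≫ Y.point.map (S.point.mapTrans K trans.app x)

/-- The identity 1-cell. -/
def Hom.id (X : GrpdAlgebra S) : X.Hom X where
  functor := 𝟭 X.carrier
  pointCell :=
    { app := fun x => X.point.map (S.point.idTor K x)
      naturality := fun x y f => by
        have h := congrArg X.point.map (S.point.idTor_natural K f)
        rw [X.point.map_comp, X.point.map_comp] at h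
        exact h }
  path_comm := fun j x => by
    have hl := (S.pathLeft j).cell_id X.point x
    have hr := (S.pathRight j).cell_id X.point x
    refine (congrArg (fun t => (X.path j).app x ≫ t) ((Category.id_comp _).symm.trans hr)).trans ?_
    refine Eq.trans ?_ (congrArg (fun t => t ≫ (X.path j).app _)
      ((Category.id_comp _).symm.trans hl)).symm
    exact ((X.path j).naturality ((S.pathArg j).idTor K x)).symm

/-- Composition of 1-cells. -/
def Hom.comp {X Y Z : GrpdAlgebra S} (f : X.Hom Y) (g : Y.Hom Z) : X.Hom Z where
  functor := f.functor ⋙ g.functor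
  pointCell :=
    { app := fun x => g.functor.map (f.pointCell.app x) ≫
        g.pointCell.app (S.point.mapObj K f.functor.obj x) ≫
        Z.point.map (S.point.compTor K f.functor.obj g.functor.obj x)
      naturality := fun x y k => by
        have h1 := congrArg g.functor.map (f.pointCell.naturality k)
        have h2 := g.pointCell.naturality (S.point.mapHom K f.functor k)
        have h3 := congrArg Z.point.map (S.point.compTor_natural K f.functor g.functor k)
        rw [g.functor.map_comp, g.functor.map_comp] at h1
        rw [Z.point.map_comp, Z.point.map_comp] at h3
        exact paste₄ h1 h2 h3 }
  path_comm := fun j x => by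
    have hl := (S.pathLeft j).cell_comp Z.point f.functor g.functor f.pointCell g.pointCell x
    have hr := (S.pathRight j).cell_comp Z.point f.functor g.functor f.pointCell g.pointCell x
    have hf := congrArg g.functor.map (f.path_comm j x)
    have hg := g.path_comm j ((S.pathArg j).mapObj K f.functor.obj x)
    have hn := (Z.path j).naturality ((S.pathArg j).compTor K f.functor.obj g.functor.obj x)
    have hf' := (g.functor.map_comp _ _).symm.trans (hf.trans (g.functor.map_comp _ _))
    exact paste₅ hf' hg hn hl hr

instance homCategory (X Y : GrpdAlgebra S) : Category.{u} (X.Hom Y) where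
  Hom f g := Hom₂ f g
  id f :=
    { trans := 𝟙 f.functor
      point_comm := fun x => by
        have h := congrArg Y.point.map (S.point.mapTrans_id K f.functor.obj x)
        rw [Y.point.map_id] at h
        refine (Category.id_comp _).trans ((Category.comp_id _).symm.trans ?_)
        exact congrArg (fun t => f.pointCell.app x ≫ t) h.symm }
  comp {f g h} θ η :=
    { trans := θ.trans ≫ η.trans
      point_comm := fun x => by
        have h := congrArg Y.point.map (S.point.mapTrans_comp K θ.trans.app η.trans.app x)
        rw [Y.point.map_comp] at h
        exact paste₆ (θ.point_comm x) (η.point_comm x) h }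
  id_comp θ := Hom₂.ext (Category.id_comp θ.trans)
  comp_id θ := Hom₂.ext (Category.comp_id θ.trans)
  assoc θ η ξ := Hom₂.ext (Category.assoc θ.trans η.trans ξ.trans)

/-- A 2-cell all of whose components are inverse to those of another one is invertible. -/
def isoMk {X Y : GrpdAlgebra S} {f g : X.Hom Y} (θ : Hom₂ f g) (η : Hom₂ g f)
    (h₁ : θ.trans ≫ η.trans = 𝟙 f.functor) (h₂ : η.trans ≫ θ.trans = 𝟙 g.functor) :
    f ≅ g where
  hom := θ
  inv := η
  hom_inv_id := Hom₂.ext h₁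
  inv_hom_id := Hom₂.ext h₂

/-- Left whiskering. -/
def whiskerLeft {X Y Z : GrpdAlgebra S} (f : X.Hom Y) {g h : Y.Hom Z} (η : Hom₂ g h) :
    Hom₂ (f.comp g) (f.comp h) where
  trans := Functor.whiskerLeft f.functor η.trans
  point_comm := fun x => by
    have h1 := η.trans.naturality (f.pointCell.app x)
    have h2 := η.point_comm (S.point.mapObj K f.functor.obj x)
    have h3 := congrArg Z.point.map (S.point.compTor_whiskerLeft K f.functor.obj η.trans.app x)
    rw [Z.point.map_comp, Z.point.map_comp] at h3
    exact paste₄ h1.symm h2 h3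

/-- Right whiskering. -/
def whiskerRight {X Y Z : GrpdAlgebra S} {f g : X.Hom Y} (η : Hom₂ f g) (h : Y.Hom Z) :
    Hom₂ (f.comp h) (g.comp h) where
  trans := Functor.whiskerRight η.trans h.functor
  point_comm := fun x => by
    have h1 := (h.functor.map_comp _ _).symm.trans
      ((congrArg h.functor.map (η.point_comm x)).trans (h.functor.map_comp _ _))
    have h2 := h.pointCell.naturality (S.point.mapTrans K η.trans.app x)
    have h3 := congrArg Z.point.map (S.point.compTor_whiskerRight K η.trans.app h.functor x)
    rw [Z.point.map_comp, Z.point.map_comp] at h3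
    exact paste₄ h1 h2 h3

theorem id_point_comm (X : GrpdAlgebra S) {T : Type u} [Groupoid.{u} T] (F : T → X.carrier)
    (x : S.point.Obj K T) {y : X.carrier} {p q : y ⟶ X.point.obj (S.point.mapObj K F x)}
    (h : q = p) :
    𝟙 y ≫ p = q ≫ X.point.map (S.point.mapTrans K (fun z => 𝟙 (F z)) x) := by
  rw [S.point.mapTrans_id K F x, X.point.map_id, Category.id_comp, Category.comp_id, h]

theorem assoc_cell {X Y Z T : GrpdAlgebra S} (f : X.Hom Y) (g : Y.Hom Z) (h : Z.Hom T)
    (x : S.point.Obj K X.carrier) :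
    ((f.comp g).comp h).pointCell.app x = (f.comp (g.comp h)).pointCell.app x := by
  have h1 := h.pointCell.naturality (S.point.compTor K f.functor.obj g.functor.obj x)
  have h2 := congrArg T.point.map
    (S.point.compTor_assoc K f.functor.obj g.functor.obj h.functor x)
  rw [T.point.map_comp, T.point.map_comp] at h2
  have h3 := h.functor.map_comp (g.functor.map (f.pointCell.app x))
    (g.pointCell.app (S.point.mapObj K f.functor.obj x) ≫
      Z.point.map (S.point.compTor K f.functor.obj g.functor.obj x))
  have h4 := h.functor.map_comp (g.pointCell.app (S.point.mapObj K f.functor.obj x))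
    (Z.point.map (S.point.compTor K f.functor.obj g.functor.obj x))
  exact paste₇ (h3.trans (congrArg (fun t => _ ≫ t) h4)) h1 h2

theorem leftUnit_cell {X Y : GrpdAlgebra S} (f : X.Hom Y) (x : S.point.Obj K X.carrier) :
    ((Hom.id X).comp f).pointCell.app x = f.pointCell.app x := by
  have h1 := f.pointCell.naturality (S.point.idTor K x)
  have h2 := congrArg Y.point.map (S.point.idTor_compTor_left K f.functor x)
  rw [Y.point.map_comp, Y.point.map_id] at h2
  exact (paste₁ h1 ((Category.assoc _ _ _).trans (congrArg (fun t => _ ≫ t) h2))).trans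
    (Category.comp_id _)

theorem rightUnit_cell {X Y : GrpdAlgebra S} (f : X.Hom Y) (x : S.point.Obj K X.carrier) :
    (f.comp (Hom.id Y)).pointCell.app x = f.pointCell.app x := by
  have h2 := congrArg Y.point.map (S.point.idTor_compTor_right K f.functor.obj x)
  rw [Y.point.map_comp, Y.point.map_id] at h2
  exact (congrArg (fun t => f.pointCell.app x ≫ t) h2).trans (Category.comp_id _)

/-- The associator; its components are identities. -/
def associator {X Y Z T : GrpdAlgebra S} (f : X.Hom Y) (g : Y.Hom Z) (h : Z.Hom T) :
    (f.comp g).comp h ≅ f.comp (g.comp h) :=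
  isoMk
    { trans := (Functor.associator f.functor g.functor h.functor).hom
      point_comm := fun x => id_point_comm T
        (fun z => h.functor.obj (g.functor.obj (f.functor.obj z))) x (assoc_cell f g h x) }
    { trans := (Functor.associator f.functor g.functor h.functor).inv
      point_comm := fun x => id_point_comm T
        (fun z => h.functor.obj (g.functor.obj (f.functor.obj z))) x (assoc_cell f g h x).symm }
    (Functor.associator f.functor g.functor h.functor).hom_inv_id
    (Functor.associator f.functor g.functor h.functor).inv_hom_id

/-- The left unitor; its components are identities. -/
def leftUnitor {X Y : GrpdAlgebra S} (f : X.Hom Y) : (Hom.id X).comp f ≅ f :=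
  isoMk
    { trans := f.functor.leftUnitor.hom
      point_comm := fun x => id_point_comm Y f.functor.obj x (leftUnit_cell f x) }
    { trans := f.functor.leftUnitor.inv
      point_comm := fun x => id_point_comm Y f.functor.obj x (leftUnit_cell f x).symm }
    f.functor.leftUnitor.hom_inv_id
    f.functor.leftUnitor.inv_hom_id

/-- The right unitor; its components are identities. -/
def rightUnitor {X Y : GrpdAlgebra S} (f : X.Hom Y) : f.comp (Hom.id Y) ≅ f :=
  isoMk
    { trans := f.functor.rightUnitor.hom
      point_comm := fun x => id_point_comm Y f.functor.obj x (rightUnit_cell f x) }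
    { trans := f.functor.rightUnitor.inv
      point_comm := fun x => id_point_comm Y f.functor.obj x (rightUnit_cell f x).symm }
    f.functor.rightUnitor.hom_inv_id
    f.functor.rightUnitor.inv_hom_id

/-- The bicategory of algebras in groupoids for a signature. -/
instance bicategory : Bicategory.{u, u} (GrpdAlgebra S) where
  Hom X Y := X.Hom Y
  id X := Hom.id X
  comp f g := f.comp g
  homCategory X Y := homCategory X Y
  whiskerLeft f _ _ η := whiskerLeft f η
  whiskerRight η h := whiskerRight η h
  associator f g h := associator f g h
  leftUnitor f := leftUnitor f
  rightUnitor f := rightUnitor f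
  whiskerLeft_id f g := Hom₂.ext (by ext; rfl)
  whiskerLeft_comp f _ _ _ η θ := Hom₂.ext (by ext; rfl)
  id_whiskerLeft {X Y f g} η := Hom₂.ext (NatTrans.ext (funext fun x =>
    ((Category.id_comp _).trans (Category.comp_id _)).symm))
  comp_whiskerLeft f g _ _ η := Hom₂.ext (NatTrans.ext (funext fun x =>
    ((Category.id_comp _).trans (Category.comp_id _)).symm))
  id_whiskerRight f g := Hom₂.ext (NatTrans.ext (funext fun x => g.functor.map_id _))
  comp_whiskerRight η θ h := Hom₂.ext (NatTrans.ext (funext fun x => h.functor.map_comp _ _))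
  whiskerRight_id η := Hom₂.ext (NatTrans.ext (funext fun x =>
    ((Category.id_comp _).trans (Category.comp_id _)).symm))
  whiskerRight_comp η g h := Hom₂.ext (NatTrans.ext (funext fun x =>
    ((Category.id_comp _).trans (Category.comp_id _)).symm))
  whisker_assoc f _ _ η h := Hom₂.ext (NatTrans.ext (funext fun x =>
    ((Category.id_comp _).trans (Category.comp_id _)).symm))
  whisker_exchange {X Y Z f g h i} η θ := Hom₂.ext (NatTrans.ext (funext fun x =>
    (θ.trans.naturality (η.trans.app x)).symm))
  pentagon f g h i := Hom₂.ext (NatTrans.ext (funext fun x =>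
    (congrArg (fun t => t ≫ _) (i.functor.map_id _)).trans (Category.id_comp _)))
  triangle f g := Hom₂.ext (NatTrans.ext (funext fun x =>
    (Category.id_comp _).trans (g.functor.map_id _).symm))

end GrpdAlgebra

/-- Biinitial objects in a bicategory. -/
structure IsBiinitial {B : Type*} [Bicategory B] (x : B) : Prop where
  exists_hom : ∀ y : B, Nonempty (x ⟶ y)
  exists_hom₂ : ∀ {y : B} (f g : x ⟶ y), Nonempty (f ⟶ g)
  hom₂_unique : ∀ {y : B} {f g : x ⟶ y} (θ θ' : f ⟶ g), θ = θ'

/-! ## Formal morphisms -/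

namespace HITSignature

variable {K : ι → Grpd.{u, u}} (S : HITSignature K)

/-- The W-type of the point polynomial. -/
def W : Type u := (S.point.container K).W

/-- The algebra map of the W-type. -/
def sup (x : S.point.Obj K S.W) : S.W := PFunctor.W.mk (S.point.toContainer K x)

/-- Formal morphisms between elements of `P(W)`. The constructor `const` reflects the paths in the
constant 1-types. -/
inductive Mor : (P : Code ι) → P.Obj K S.W → P.Obj K S.W → Type u
  | id (P : Code ι) (x : P.Obj K S.W) : Mor P x x
  | inv {P : Code ι} {x y : P.Obj K S.W} (f : Mor P x y) : Mor P y x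
  | comp {P : Code ι} {x y z : P.Obj K S.W} (f : Mor P x y) (g : Mor P y z) : Mor P x z
  | inl {P Q : Code ι} {x y : P.Obj K S.W} (f : Mor P x y) :
      Mor (Code.sum P Q) (Sum.inl x) (Sum.inl y)
  | inr {P Q : Code ι} {x y : Q.Obj K S.W} (f : Mor Q x y) :
      Mor (Code.sum P Q) (Sum.inr x) (Sum.inr y)
  | pair {P Q : Code ι} {x y : P.Obj K S.W} {w z : Q.Obj K S.W} (f : Mor P x y) (g : Mor Q w z) :
      Mor (Code.prod P Q) (x, w) (y, z)
  | path (j : S.PathLabel) (x : (S.pathArg j).Obj K S.W) :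
      Mor Code.id ((S.pathLeft j).obj S.sup x) ((S.pathRight j).obj S.sup x)
  | ap {x y : S.point.Obj K S.W} (f : Mor S.point x y) : Mor Code.id (S.sup x) (S.sup y)
  | const {i : ι} {x y : K i} (k : x ⟶ y) : Mor (Code.const i) x y

namespace Mor

variable {S}

/-- Auxiliary family for `fst`. -/
def FstMotive : (P : Code ι) → P.Obj K S.W → P.Obj K S.W → Type u
  | Code.prod P _, x, y => S.Mor P x.1 y.1
  | _, _, _ => PUnit

/-- Auxiliary definition for `fst`. -/
def fstAux : {P : Code ι} → {x y : P.Obj K S.W} → S.Mor P x y → FstMotive (S := S) P x y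
  | Code.prod P _, _, _, id _ x => id P x.1
  | Code.prod _ _, _, _, inv f => inv (fstAux f)
  | Code.prod _ _, _, _, comp f g => comp (fstAux f) (fstAux g)
  | Code.prod _ _, _, _, pair f _ => f
  | Code.const _, _, _, _ => PUnit.unit
  | Code.id, _, _, _ => PUnit.unit
  | Code.sum _ _, _, _, _ => PUnit.unit

/-- The first component of a formal morphism of pairs. -/
def fst {P Q : Code ι} {x y : (Code.prod P Q).Obj K S.W} (f : S.Mor (Code.prod P Q) x y) :
    S.Mor P x.1 y.1 := fstAux f

/-- Auxiliary family for `snd`. -/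
def SndMotive : (P : Code ι) → P.Obj K S.W → P.Obj K S.W → Type u
  | Code.prod _ Q, x, y => S.Mor Q x.2 y.2
  | _, _, _ => PUnit

/-- Auxiliary definition for `snd`. -/
def sndAux : {P : Code ι} → {x y : P.Obj K S.W} → S.Mor P x y → SndMotive (S := S) P x y
  | Code.prod _ Q, _, _, id _ x => id Q x.2
  | Code.prod _ _, _, _, inv f => inv (sndAux f)
  | Code.prod _ _, _, _, comp f g => comp (sndAux f) (sndAux g)
  | Code.prod _ _, _, _, pair _ g => g
  | Code.const _, _, _, _ => PUnit.unit
  | Code.id, _, _, _ => PUnit.unit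
  | Code.sum _ _, _, _, _ => PUnit.unit

/-- The second component of a formal morphism of pairs. -/
def snd {P Q : Code ι} {x y : (Code.prod P Q).Obj K S.W} (f : S.Mor (Code.prod P Q) x y) :
    S.Mor Q x.2 y.2 := sndAux f

/-- Auxiliary family for `toConst`. -/
def ConstMotive : (P : Code ι) → P.Obj K S.W → P.Obj K S.W → Type u
  | Code.const i, x, y => @Quiver.Hom (K i) _ x y
  | _, _, _ => PUnit

/-- Auxiliary definition for `toConst`. -/
def toConstAux : {P : Code ι} → {x y : P.Obj K S.W} → S.Mor P x y → ConstMotive (S := S) P x y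
  | Code.const i, _, _, id _ x => @CategoryStruct.id (K i) _ x
  | Code.const i, _, _, inv f => @Groupoid.inv (K i) _ _ _ (toConstAux f)
  | Code.const i, _, _, comp f g => @CategoryStruct.comp (K i) _ _ _ _ (toConstAux f) (toConstAux g)
  | Code.const _, _, _, const k => k
  | Code.prod _ _, _, _, _ => PUnit.unit
  | Code.id, _, _, _ => PUnit.unit
  | Code.sum _ _, _, _, _ => PUnit.unit

/-- A formal morphism between elements of a constant `K i` gives a morphism in `K i`. -/
def toConst {i : ι} {x y : K i} (f : S.Mor (Code.const i) x y) : x ⟶ y := toConstAux f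

/-- The action of a path endpoint on formal morphisms. -/
def act : {P Q : Code ι} → (e : Endpoint K S.point P Q) → {x y : P.Obj K S.W} →
    S.Mor P x y → S.Mor Q (e.obj S.sup x) (e.obj S.sup y)
  | _, _, Endpoint.id _, _, _, f => f
  | _, _, Endpoint.comp e₁ e₂, _, _, f => act e₂ (act e₁ f)
  | _, _, Endpoint.constr, _, _, f => ap f
  | _, _, Endpoint.inl _ _, _, _, f => inl f
  | _, _, Endpoint.inr _ _, _, _, f => inr f
  | _, _, Endpoint.fst _ _, _, _, f => fst f
  | _, _, Endpoint.snd _ _, _, _, f => snd f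
  | _, _, Endpoint.pair e₁ e₂, _, _, f => pair (act e₁ f) (act e₂ f)
  | _, _, Endpoint.const (i := i) _ x, _, _, _ => id (Code.const i) x
  | _, _, Endpoint.fmap F, _, _, f => const (F.map (toConst f))

/-- The interpretation of a homotopy endpoint as a formal morphism, at `x` in `R(W)` and a formal
morphism `w` from `a(x)` to `b(x)`. -/
def interp {R T : Code ι} {a b : Endpoint K S.point R T} {x : R.Obj K S.W}
    (w : S.Mor T (a.obj S.sup x) (b.obj S.sup x)) :
    {W : Code ι} → {s t : Endpoint K S.point R W} →
    HomotEndpoint S.pathLeft S.pathRight a b s t → S.Mor W (s.obj S.sup x) (t.obj S.sup x)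
  | _, _, _, HomotEndpoint.refl _ => id _ _
  | _, _, _, HomotEndpoint.symm h => inv (interp w h)
  | _, _, _, HomotEndpoint.trans h₁ h₂ => comp (interp w h₁) (interp w h₂)
  | _, _, _, HomotEndpoint.ap e h => act e (interp w h)
  | _, _, _, HomotEndpoint.assoc _ _ _ => id _ _
  | _, _, _, HomotEndpoint.lunit _ => id _ _
  | _, _, _, HomotEndpoint.runit _ => id _ _
  | _, _, _, HomotEndpoint.pairFst _ _ => id _ _
  | _, _, _, HomotEndpoint.pairSnd _ _ => id _ _
  | _, _, _, HomotEndpoint.pair h₁ h₂ => pair (interp w h₁) (interp w h₂)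
  | _, _, _, HomotEndpoint.compPair _ _ _ => id _ _
  | _, _, _, HomotEndpoint.compConst _ _ => id _ _
  | _, _, _, HomotEndpoint.path j e => path j (e.obj S.sup x)
  | _, _, _, HomotEndpoint.arg => w
  | _, _, _, HomotEndpoint.constHom k => const k
  | _, _, _, HomotEndpoint.fmapHom e α => const (α.app (e.obj S.sup x))

end Mor

/-! ## The congruence on formal morphisms -/

open Mor in
/-- The inductively generated congruence on formal morphisms. The constructors `constId` and
`constComp` reflect the groupoid structure of the paths in the constant 1-types. -/
inductive Rel : {P : Code ι} → {x y : P.Obj K S.W} → S.Mor P x y → S.Mor P x y → Type u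
  | refl {P : Code ι} {x y : P.Obj K S.W} (f : S.Mor P x y) : Rel f f
  | symm {P : Code ι} {x y : P.Obj K S.W} {f g : S.Mor P x y} (h : Rel f g) : Rel g f
  | trans {P : Code ι} {x y : P.Obj K S.W} {f g k : S.Mor P x y} (h₁ : Rel f g) (h₂ : Rel g k) :
      Rel f k
  | compId {P : Code ι} {x y : P.Obj K S.W} (f : S.Mor P x y) : Rel (comp f (id P y)) f
  | idComp {P : Code ι} {x y : P.Obj K S.W} (f : S.Mor P x y) : Rel (comp (id P x) f) f
  | assoc {P : Code ι} {w x y z : P.Obj K S.W} (f : S.Mor P w x) (g : S.Mor P x y)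
      (h : S.Mor P y z) : Rel (comp f (comp g h)) (comp (comp f g) h)
  | compInv {P : Code ι} {x y : P.Obj K S.W} (f : S.Mor P x y) : Rel (comp f (inv f)) (id P x)
  | invComp {P : Code ι} {x y : P.Obj K S.W} (f : S.Mor P x y) : Rel (comp (inv f) f) (id P y)
  | invCongr {P : Code ι} {x y : P.Obj K S.W} {f g : S.Mor P x y} (h : Rel f g) :
      Rel (inv f) (inv g)
  | compCongrLeft {P : Code ι} {x y z : P.Obj K S.W} {f₁ f₂ : S.Mor P x y} (g : S.Mor P y z)
      (h : Rel f₁ f₂) : Rel (comp f₁ g) (comp f₂ g)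
  | compCongrRight {P : Code ι} {x y z : P.Obj K S.W} (f : S.Mor P x y) {g₁ g₂ : S.Mor P y z}
      (h : Rel g₁ g₂) : Rel (comp f g₁) (comp f g₂)
  | apId (x : S.point.Obj K S.W) : Rel (ap (id S.point x)) (id Code.id (S.sup x))
  | apCongr {x y : S.point.Obj K S.W} {f g : S.Mor S.point x y} (h : Rel f g) :
      Rel (ap f) (ap g)
  | apComp {x y z : S.point.Obj K S.W} (f : S.Mor S.point x y) (g : S.Mor S.point y z) :
      Rel (ap (comp f g)) (comp (ap f) (ap g))
  | inlId {P Q : Code ι} (x : P.Obj K S.W) :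
      Rel (inl (Q := Q) (id P x)) (id (Code.sum P Q) (Sum.inl x))
  | inrId {P Q : Code ι} (x : Q.Obj K S.W) :
      Rel (inr (P := P) (id Q x)) (id (Code.sum P Q) (Sum.inr x))
  | inlCongr {P Q : Code ι} {x y : P.Obj K S.W} {f g : S.Mor P x y} (h : Rel f g) :
      Rel (inl (Q := Q) f) (inl (Q := Q) g)
  | inlComp {P Q : Code ι} {x y z : P.Obj K S.W} (f : S.Mor P x y) (g : S.Mor P y z) :
      Rel (inl (Q := Q) (comp f g)) (comp (inl f) (inl g))
  | inrCongr {P Q : Code ι} {x y : Q.Obj K S.W} {f g : S.Mor Q x y} (h : Rel f g) :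
      Rel (inr (P := P) f) (inr (P := P) g)
  | inrComp {P Q : Code ι} {x y z : Q.Obj K S.W} (f : S.Mor Q x y) (g : S.Mor Q y z) :
      Rel (inr (P := P) (comp f g)) (comp (inr f) (inr g))
  | pairId {P Q : Code ι} (x : P.Obj K S.W) (y : Q.Obj K S.W) :
      Rel (pair (id P x) (id Q y)) (id (Code.prod P Q) (x, y))
  | pairCongr {P Q : Code ι} {x₁ x₂ : P.Obj K S.W} {y₁ y₂ : Q.Obj K S.W}
      {f₁ f₂ : S.Mor P x₁ x₂} {g₁ g₂ : S.Mor Q y₁ y₂} (h₁ : Rel f₁ f₂) (h₂ : Rel g₁ g₂) :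
      Rel (pair f₁ g₁) (pair f₂ g₂)
  | pairComp {P Q : Code ι} {x₁ y₁ z₁ : P.Obj K S.W} {x₂ y₂ z₂ : Q.Obj K S.W}
      (f₁ : S.Mor P x₁ y₁) (g₁ : S.Mor P y₁ z₁) (f₂ : S.Mor Q x₂ y₂) (g₂ : S.Mor Q y₂ z₂) :
      Rel (pair (comp f₁ g₁) (comp f₂ g₂)) (comp (pair f₁ f₂) (pair g₁ g₂))
  | homot (j : S.HomotLabel) (x : (S.homotPointArg j).Obj K S.W)
      (p : S.Mor (S.homotPathArg j) ((S.argLeft j).obj S.sup x) ((S.argRight j).obj S.sup x)) :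
      Rel (interp p (S.homotLeft j)) (interp p (S.homotRight j))
  | pathNatural (j : S.PathLabel) {x y : (S.pathArg j).Obj K S.W}
      (p : S.Mor (S.pathArg j) x y) :
      Rel (comp (path j x) (act (S.pathRight j) p)) (comp (act (S.pathLeft j) p) (path j y))
  | constId {i : ι} (x : K i) : Rel (const (𝟙 x)) (id (Code.const i) x)
  | constComp {i : ι} {x y z : K i} (k : x ⟶ y) (l : y ⟶ z) :
      Rel (const (k ≫ l)) (comp (const k) (const l))

/-- The propositional truncation of the congruence, on formal morphisms between elements of `W`. -/
def setoid (x y : S.W) : Setoid (S.Mor Code.id x y) where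
  r f g := Nonempty (S.Rel f g)
  iseqv :=
    { refl := fun f => ⟨Rel.refl f⟩
      symm := fun ⟨h⟩ => ⟨Rel.symm h⟩
      trans := fun ⟨h⟩ ⟨k⟩ => ⟨Rel.trans h k⟩ }

/-- The groupoid whose objects form the W-type `S.W` and whose morphisms form the set quotient
of the formal morphisms by the truncated congruence. -/
instance groupoidW : Groupoid.{u} S.W where
  Hom x y := Quotient (S.setoid x y)
  id x := Quotient.mk (S.setoid x x) (Mor.id Code.id x)
  comp {x y z} := Quotient.map₂ (sa := S.setoid x y) (sb := S.setoid y z) (sc := S.setoid x z)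
    (fun f g => Mor.comp f g)
    (fun _ _ ⟨h⟩ _ _ ⟨k⟩ => ⟨Rel.trans (Rel.compCongrLeft _ h) (Rel.compCongrRight _ k)⟩)
  inv {x y} := Quotient.map (sa := S.setoid x y) (sb := S.setoid y x) (fun f => Mor.inv f)
    (fun _ _ ⟨h⟩ => ⟨Rel.invCongr h⟩)
  id_comp := by rintro x y ⟨f⟩; exact Quotient.sound ⟨Rel.idComp f⟩
  comp_id := by rintro x y ⟨f⟩; exact Quotient.sound ⟨Rel.compId f⟩
  assoc := by rintro w x y z ⟨f⟩ ⟨g⟩ ⟨h⟩; exact Quotient.sound ⟨Rel.symm (Rel.assoc f g h)⟩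
  inv_comp := by rintro x y ⟨f⟩; exact Quotient.sound ⟨Rel.invComp f⟩
  comp_inv := by rintro x y ⟨f⟩; exact Quotient.sound ⟨Rel.compInv f⟩

/-- The class of a formal morphism. -/
def cls {x y : S.W} (f : S.Mor Code.id x y) : x ⟶ y := Quotient.mk (S.setoid x y) f

/-- The morphism of the groupoid `P(W)` that is denoted by a formal morphism. -/
def realize : {P : Code ι} → {x y : P.Obj K S.W} → S.Mor P x y → (x ⟶ y)
  | _, _, _, Mor.id _ x => 𝟙 x
  | _, _, _, Mor.inv f => Groupoid.inv (realize f)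
  | _, _, _, Mor.comp f g => realize f ≫ realize g
  | _, _, _, Mor.inl f => ULift.up (realize f)
  | _, _, _, Mor.inr f => ULift.up (realize f)
  | _, _, _, Mor.pair f g => (realize f, realize g)
  | _, _, _, Mor.path j x => S.cls (Mor.path j x)
  | _, _, _, Mor.ap f => S.cls (Mor.ap f)
  | _, _, _, Mor.const k => k

/-- Functors `P(W) ⥤ W`, for the point polynomial `P`, whose action on objects is the algebra map
of the W-type. -/
structure PointFunctor where
  map : ∀ {x y : S.point.Obj K S.W}, (x ⟶ y) → (S.sup x ⟶ S.sup y)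
  map_id : ∀ x : S.point.Obj K S.W, map (𝟙 x) = 𝟙 (S.sup x)
  map_comp : ∀ {x y z : S.point.Obj K S.W} (f : x ⟶ y) (g : y ⟶ z),
    map (f ≫ g) = map f ≫ map g

/-- The underlying functor. -/
def PointFunctor.toFunctor {S : HITSignature K} (c : S.PointFunctor) :
    S.point.Obj K S.W ⥤ S.W where
  obj := S.sup
  map := c.map
  map_id := c.map_id
  map_comp := c.map_comp

end HITSignature

end GrpdHIT

/-!
The idea is to present each groupoid `P(W)` by formal morphisms, and then to argue by recursion on
formal morphisms and by recursion on the W-type.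

*Presentation of `P(W)`.* By definition only the morphisms of `W` itself are classes of formal
morphisms; those of `P(W)` are computed by recursion on `P`. The map `realize` from formal morphisms
to morphisms of `P(W)` is surjective with section `reify` (`realize_reify`), and it identifies two
formal morphisms exactly when they are congruent: `reify_realize` is completeness,
`realize_eq_of_rel` is soundness. So `P(W)` may be treated as the quotient of the formal morphisms
for every code `P`, which makes `ap` a functor `A(W) ⥤ W` and `path` a family of natural
transformations. Since `realize` commutes with the actions of endpoints and of homotopy endpoints
(`realize_act`, `realize_interp`), the homotopy rule of the congruence says that these data form an
algebra.

*Existence of 1-cells.* For an algebra `Y`, recursion on the W-type gives a map `F : W → Y` with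
cells `τ` which make it commute with the point operations. The map extends to formal morphisms
(`eval`): `path` and `ap` go to the operations of `Y`, conjugated by the cells that `τ` induces.
Cells of endpoints are natural with respect to `eval` (`eval_act`) and compatible with homotopy
endpoints (`eval_interp`), so `eval` respects the congruence (`eval_eq_of_rel`) and descends to a
functor.

*2-cells.* The equation for a 2-cell `θ` at the point operation determines `θ` at `sup x` from its
values at the positions of `x`. Recursion on the W-type therefore gives exactly one family with this
property, and the family is natural by induction on formal morphisms
(`mapTrans_natural_of_point_comm`).
-/

namespace GrpdHIT

variable {ι : Type u}

/-! ### Recursion over the W-type, and naturality of endpoints -/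

namespace Code

variable {K : ι → Grpd.{u, u}}

/-- The type of families of elements of `M`, indexed by the positions of `x` in `P(X)`. -/
def All {X : Type u} (M : X → Type u) : (P : Code ι) → P.Obj K X → Type u
  | const _, _ => PUnit
  | id, x => M x
  | sum P _, Sum.inl x => All M P x
  | sum _ Q, Sum.inr x => All M Q x
  | prod P Q, x => All M P x.1 × All M Q x.2

/-- The restriction of a dependent function to the positions of an element of `P(X)`. -/
def all {X : Type u} {M : X → Type u} (r : ∀ x, M x) : (P : Code ι) → (x : P.Obj K X) → All M P x
  | const _, _ => PUnit.unit
  | id, x => r x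
  | sum P _, Sum.inl x => all r P x
  | sum _ Q, Sum.inr x => all r Q x
  | prod P Q, x => (all r P x.1, all r Q x.2)

/-- A family indexed by the positions of the container is a family in the sense of `All`. -/
def allOfContainer {X : Type u} {M : X → Type u} : (P : Code ι) → (x : P.Obj K X) →
    (∀ b, M ((P.toContainer K x).2 b)) → All M P x
  | const _, _, _ => PUnit.unit
  | id, _, v => v PUnit.unit
  | sum P _, Sum.inl x, v => allOfContainer P x v
  | sum _ Q, Sum.inr x, v => allOfContainer Q x v
  | prod P Q, x, v =>
    (allOfContainer P x.1 (fun b => v (Sum.inl b)), allOfContainer Q x.2 (fun b => v (Sum.inr b)))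

theorem allOfContainer_apply {X : Type u} {M : X → Type u} (r : ∀ x, M x) (P : Code ι)
    (x : P.Obj K X) : P.allOfContainer x (fun b => r ((P.toContainer K x).2 b)) = P.all r x := by
  induction P with
  | const i => rfl
  | id => rfl
  | sum P Q ihP ihQ =>
    cases x with
    | inl x => exact ihP x
    | inr x => exact ihQ x
  | prod P Q ihP ihQ => exact Prod.ext (ihP x.1) (ihQ x.2)

/-- A family of elements of `Y` at the positions of an element of `P(X)` gives an element
of `P(Y)` of the same shape. -/
def assemble {X Y : Type u} : (P : Code ι) → (x : P.Obj K X) → All (fun _ => Y) P x → P.Obj K Y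
  | const _, x, _ => x
  | id, _, y => y
  | sum P _, Sum.inl x, v => Sum.inl (assemble P x v)
  | sum _ Q, Sum.inr x, v => Sum.inr (assemble Q x v)
  | prod P Q, x, v => (assemble P x.1 v.1, assemble Q x.2 v.2)

theorem assemble_all {X Y : Type u} (F : X → Y) (P : Code ι) (x : P.Obj K X) :
    P.assemble x (P.all F x) = P.mapObj K F x := by
  induction P with
  | const i => rfl
  | id => rfl
  | sum P Q ihP ihQ =>
    cases x with
    | inl x => exact congrArg Sum.inl (ihP x)
    | inr x => exact congrArg Sum.inr (ihQ x)
  | prod P Q ihP ihQ => exact Prod.ext (ihP x.1) (ihQ x.2)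

/-- A family of morphisms at the positions of an element of `P(X)` gives a morphism of `P(Y)`. -/
def assembleHom {X Y : Type u} [Groupoid.{u} Y] {F G : X → Y} : (P : Code ι) → (x : P.Obj K X) →
    All (fun z => F z ⟶ G z) P x → (P.mapObj K F x ⟶ P.mapObj K G x)
  | const i, x, _ => @CategoryStruct.id (K i) _ x
  | id, _, f => f
  | sum P _, Sum.inl x, v => ULift.up (assembleHom P x v)
  | sum _ Q, Sum.inr x, v => ULift.up (assembleHom Q x v)
  | prod P Q, x, v => (assembleHom P x.1 v.1, assembleHom Q x.2 v.2)

theorem assembleHom_all {X Y : Type u} [Groupoid.{u} Y] {F G : X → Y} (θ : ∀ z, F z ⟶ G z)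
    (P : Code ι) (x : P.Obj K X) : P.assembleHom x (P.all θ x) = P.mapTrans K θ x := by
  induction P with
  | const i => rfl
  | id => rfl
  | sum P Q ihP ihQ =>
    cases x with
    | inl x => exact congrArg ULift.up (ihP x)
    | inr x => exact congrArg ULift.up (ihQ x)
  | prod P Q ihP ihQ => exact Prod.ext (ihP x.1) (ihQ x.2)

theorem mapTrans_congr {X Y : Type u} [Groupoid.{u} Y] {F G : X → Y} (θ η : ∀ z, F z ⟶ G z)
    (P : Code ι) (x : P.Obj K X) (h : All (fun z => ULift.{u} (PLift (θ z = η z))) P x) :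
    P.mapTrans K θ x = P.mapTrans K η x := by
  induction P with
  | const i => rfl
  | id => exact h.down.down
  | sum P Q ihP ihQ =>
    cases x with
    | inl x => exact congrArg ULift.up (ihP x h)
    | inr x => exact congrArg ULift.up (ihQ x h)
  | prod P Q ihP ihQ => exact Prod.ext (ihP x.1 h.1) (ihQ x.2 h.2)

theorem mapHom_inv {X Y : Type u} [Groupoid.{u} X] [Groupoid.{u} Y] (P : Code ι) (F : X ⥤ Y)
    {x y : P.Obj K X} (f : x ⟶ y) :
    P.mapHom K F (Groupoid.inv f) = Groupoid.inv (P.mapHom K F f) := by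
  have h := (P.functor K F).map_inv f
  rw [← Groupoid.inv_eq_inv, ← Groupoid.inv_eq_inv] at h
  exact h

end Code

namespace Endpoint

variable {K : ι → Grpd.{u, u}} {A : Code ι} {X Y : Type u} [Groupoid.{u} X] [Groupoid.{u} Y]

/-- A transformation that is compatible with the point cells is compatible with the cells of all
endpoints. -/
theorem mapTrans_cell {c : A.Obj K X → X} (d : A.Obj K Y ⥤ Y) {F G : X → Y}
    {τ : ∀ x, F (c x) ⟶ d.obj (A.mapObj K F x)} {σ : ∀ x, G (c x) ⟶ d.obj (A.mapObj K G x)}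
    {θ : ∀ z, F z ⟶ G z} (hθ : ∀ x, θ (c x) ≫ σ x = τ x ≫ d.map (A.mapTrans K θ x))
    {P Q : Code ι} (e : Endpoint K A P Q) (x : P.Obj K X) :
    Q.mapTrans K θ (e.obj c x) ≫ e.cell d G σ x =
      e.cell d F τ x ≫ e.map d (P.mapTrans K θ x) := by
  induction e with
  | id P => exact (Category.comp_id _).trans (Category.id_comp _).symm
  | comp e₁ e₂ ih₁ ih₂ =>
    have h := congrArg (e₂.map d) (ih₁ x)
    rw [map_comp, map_comp] at h
    exact paste₂ (ih₂ (e₁.obj c x)) h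
  | constr => exact hθ x
  | inl P Q => exact (Category.comp_id _).trans (Category.id_comp _).symm
  | inr P Q => exact (Category.comp_id _).trans (Category.id_comp _).symm
  | fst P Q => exact (Category.comp_id _).trans (Category.id_comp _).symm
  | snd P Q => exact (Category.comp_id _).trans (Category.id_comp _).symm
  | pair e₁ e₂ ih₁ ih₂ => exact Prod.ext (ih₁ x) (ih₂ x)
  | const P x => exact (Category.comp_id _).trans (Category.id_comp _).symm
  | fmap F =>
    exact (Category.comp_id _).trans ((F.map_id _).symm.trans (Category.id_comp _).symm)

end Endpoint

namespace HITSignature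

variable {K : ι → Grpd.{u, u}} (S : HITSignature K)

/-- Recursion over the W-type with its computation rule, phrased with elements of `A(W)` in place of
shapes and positions. -/
theorem exists_rec {M : S.W → Type u} (step : ∀ x, Code.All M S.point x → M (S.sup x)) :
    ∃ r : ∀ w, M w, ∀ x, r (S.sup x) = step x (S.point.all r x) := by
  have hsurj := (S.point.toContainer_bijective K S.W).2
  have hinj := (S.point.toContainer_bijective K S.W).1
  let st : ∀ (p : (S.point.container K) S.W), (∀ b, M (p.2 b)) → M (PFunctor.W.mk p) := fun p v =>
    -- an element of `A(W)` with container `p` is chosen, and the value at it is transported to `p`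
    let x := (hsurj p).choose
    have hx : S.point.toContainer K x = p := (hsurj p).choose_spec
    Eq.rec (motive := fun p _ => (∀ b, M (p.2 b)) → M (PFunctor.W.mk p))
      (fun v => step x (S.point.allOfContainer x v)) hx v
  let r : ∀ w, M w := fun w => WType.rec (motive := M) (fun a f ih => st ⟨a, f⟩ ih) w
  refine ⟨r, fun x => ?_⟩
  -- by injectivity of `toContainer`, the chosen element is `x`, so that the transport is trivial
  have key : ∀ (y : S.point.Obj K S.W) (h : S.point.toContainer K y = S.point.toContainer K x)
      (v : ∀ b, M ((S.point.toContainer K x).2 b)),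
      Eq.rec (motive := fun p _ => (∀ b, M (p.2 b)) → M (PFunctor.W.mk p))
        (fun v => step y (S.point.allOfContainer y v)) h v =
          step x (S.point.allOfContainer x v) := by
    intro y h v
    obtain rfl := hinj h
    rfl
  refine (key _ (hsurj (S.point.toContainer K x)).choose_spec
    (fun b => r ((S.point.toContainer K x).2 b))).trans ?_
  rw [Code.allOfContainer_apply]

end HITSignature

/-! ### Formal morphisms present the groupoids on polynomials -/

namespace HITSignature

variable {K : ι → Grpd.{u, u}} (S : HITSignature K)

/-- The truncated congruence on formal morphisms, for an arbitrary code. -/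
def TruncRel {P : Code ι} {x y : P.Obj K S.W} (f g : S.Mor P x y) : Prop :=
  Nonempty (S.Rel f g)

variable {S}

namespace TruncRel

variable {P : Code ι}

theorem symm {x y : P.Obj K S.W} {f g : S.Mor P x y} : S.TruncRel f g → S.TruncRel g f :=
  fun ⟨h⟩ => ⟨Rel.symm h⟩

theorem trans {x y : P.Obj K S.W} {f g k : S.Mor P x y} :
    S.TruncRel f g → S.TruncRel g k → S.TruncRel f k :=
  fun ⟨h⟩ ⟨h'⟩ => ⟨Rel.trans h h'⟩

theorem comp {x y z : P.Obj K S.W} {f f' : S.Mor P x y} {g g' : S.Mor P y z} :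
    S.TruncRel f f' → S.TruncRel g g' → S.TruncRel (Mor.comp f g) (Mor.comp f' g') :=
  fun ⟨h⟩ ⟨h'⟩ => ⟨Rel.trans (Rel.compCongrLeft _ h) (Rel.compCongrRight _ h')⟩

theorem pair {P Q : Code ι} {x₁ x₂ : P.Obj K S.W} {y₁ y₂ : Q.Obj K S.W}
    {f₁ f₂ : S.Mor P x₁ x₂} {g₁ g₂ : S.Mor Q y₁ y₂} :
    S.TruncRel f₁ f₂ → S.TruncRel g₁ g₂ → S.TruncRel (Mor.pair f₁ g₁) (Mor.pair f₂ g₂) :=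
  fun ⟨h⟩ ⟨h'⟩ => ⟨Rel.pairCongr h h'⟩

theorem inl {P Q : Code ι} {x y : P.Obj K S.W} {f g : S.Mor P x y} :
    S.TruncRel f g → S.TruncRel (Mor.inl (Q := Q) f) (Mor.inl (Q := Q) g) :=
  fun ⟨h⟩ => ⟨Rel.inlCongr h⟩

theorem inr {P Q : Code ι} {x y : Q.Obj K S.W} {f g : S.Mor Q x y} :
    S.TruncRel f g → S.TruncRel (Mor.inr (P := P) f) (Mor.inr (P := P) g) :=
  fun ⟨h⟩ => ⟨Rel.inrCongr h⟩

theorem ap {x y : S.point.Obj K S.W} {f g : S.Mor S.point x y} :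
    S.TruncRel f g → S.TruncRel (Mor.ap f) (Mor.ap g) :=
  fun ⟨h⟩ => ⟨Rel.apCongr h⟩

/-- A formal right inverse of `f'` is congruent to the formal inverse of any `f` congruent to `f'`. -/
theorem inv_of_comp {x y : P.Obj K S.W} {f f' : S.Mor P x y} {g : S.Mor P y x}
    (hf : S.TruncRel f' f) (h : S.TruncRel (Mor.comp f' g) (Mor.id P x)) :
    S.TruncRel g (Mor.inv f) := by
  obtain ⟨hf⟩ := hf
  obtain ⟨h⟩ := h
  exact ⟨(Rel.idComp g).symm.trans <|
    (Rel.compCongrLeft g (Rel.invComp f).symm).trans <|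
    (Rel.assoc _ _ _).symm.trans <|
    (Rel.compCongrRight _ ((Rel.compCongrLeft g hf.symm).trans h)).trans (Rel.compId _)⟩

end TruncRel

theorem cls_eq_iff {x y : S.W} {f g : S.Mor Code.id x y} : S.cls f = S.cls g ↔ S.TruncRel f g :=
  Quotient.eq (r := S.setoid x y)

/-- A formal morphism that denotes a given morphism of `P(W)`. -/
noncomputable def reify : (P : Code ι) → {x y : P.Obj K S.W} → (x ⟶ y) → S.Mor P x y
  | Code.const _, _, _, k => Mor.const k
  | Code.id, x, y, f => Quotient.out (s := S.setoid x y) f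
  | Code.sum P _, Sum.inl _, Sum.inl _, f => Mor.inl (reify P f.down)
  | Code.sum _ Q, Sum.inr _, Sum.inr _, f => Mor.inr (reify Q f.down)
  | Code.prod P Q, _, _, f => Mor.pair (reify P f.1) (reify Q f.2)

theorem cls_reify {x y : S.W} (f : x ⟶ y) : S.cls (reify Code.id f) = f :=
  Quotient.out_eq (s := S.setoid x y) f

theorem reify_id (P : Code ι) (x : P.Obj K S.W) : S.TruncRel (reify P (𝟙 x)) (Mor.id P x) := by
  induction P with
  | const i => exact ⟨Rel.constId x⟩
  | id => exact cls_eq_iff.1 (cls_reify (𝟙 (show S.W from x)))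
  | sum P Q ihP ihQ =>
    cases x with
    | inl x => exact (ihP x).inl.trans ⟨Rel.inlId x⟩
    | inr x => exact (ihQ x).inr.trans ⟨Rel.inrId x⟩
  | prod P Q ihP ihQ => exact ((ihP x.1).pair (ihQ x.2)).trans ⟨Rel.pairId x.1 x.2⟩

theorem reify_comp (P : Code ι) {x y z : P.Obj K S.W} (f : x ⟶ y) (g : y ⟶ z) :
    S.TruncRel (reify P (f ≫ g)) (Mor.comp (reify P f) (reify P g)) := by
  induction P with
  | const i => exact ⟨Rel.constComp f g⟩
  | id =>
    refine cls_eq_iff.1 ((cls_reify (S := S) (x := x) (y := z) (f ≫ g)).trans ?_)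
    exact (congrArg₂ (fun (a : Quiver.Hom (V := S.W) x y) (b : Quiver.Hom (V := S.W) y z) => a ≫ b)
      (cls_reify (S := S) f) (cls_reify (S := S) g)).symm
  | sum P Q ihP ihQ =>
    match x, y, z, f, g with
    | Sum.inl _, Sum.inl _, Sum.inl _, f, g =>
      exact (ihP f.down g.down).inl.trans ⟨Rel.inlComp _ _⟩
    | Sum.inr _, Sum.inr _, Sum.inr _, f, g =>
      exact (ihQ f.down g.down).inr.trans ⟨Rel.inrComp _ _⟩
  | prod P Q ihP ihQ => exact ((ihP f.1 g.1).pair (ihQ f.2 g.2)).trans ⟨Rel.pairComp _ _ _ _⟩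

/-- Completeness of the congruence: every formal morphism is congruent to the chosen
representative of the morphism that it denotes. -/
theorem reify_realize {P : Code ι} {x y : P.Obj K S.W} (f : S.Mor P x y) :
    S.TruncRel (reify P (S.realize f)) f := by
  induction f with
  | id P x => exact reify_id P x
  | @inv P x y f ih =>
    refine ih.inv_of_comp ((reify_comp P _ _).symm.trans ?_)
    change S.TruncRel (reify P (S.realize f ≫ Groupoid.inv (S.realize f))) _
    rw [Groupoid.comp_inv]
    exact reify_id P x
  | @comp P x y z f g ihf ihg => exact (reify_comp P _ _).trans (ihf.comp ihg)
  | inl f ih => exact ih.inl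
  | inr f ih => exact ih.inr
  | pair f g ihf ihg => exact ihf.pair ihg
  | path j x => exact cls_eq_iff.1 (cls_reify _)
  | ap f ih => exact cls_eq_iff.1 (cls_reify _)
  | const k => exact ⟨Rel.refl _⟩

theorem realize_eq_cls {x y : S.W} (f : S.Mor Code.id x y) : S.realize f = S.cls f :=
  (cls_reify _).symm.trans (cls_eq_iff.2 (reify_realize f))

theorem cls_congr {x y : S.W} {f g : S.Mor Code.id x y} (h : S.Rel f g) : S.cls f = S.cls g :=
  Quotient.sound (s := S.setoid x y) ⟨h⟩

theorem realize_reify (P : Code ι) {x y : P.Obj K S.W} (f : x ⟶ y) :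
    S.realize (reify P f) = f := by
  induction P with
  | const i => rfl
  | id => exact (realize_eq_cls _).trans (cls_reify f)
  | sum P Q ihP ihQ =>
    match x, y, f with
    | Sum.inl _, Sum.inl _, f => exact congrArg ULift.up (ihP f.down)
    | Sum.inr _, Sum.inr _, f => exact congrArg ULift.up (ihQ f.down)
  | prod P Q ihP ihQ => exact Prod.ext (ihP f.1) (ihQ f.2)

/-- Soundness of the congruence: congruent formal morphisms denote the same morphism. -/
theorem realize_eq_of_rel {P : Code ι} {x y : P.Obj K S.W} {f g : S.Mor P x y} (h : S.Rel f g) :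
    S.realize f = S.realize g := by
  -- on the identity code, `realize` is the class map, which respects the congruence by definition
  have sound {x y : S.W} {f g : S.Mor Code.id x y} (h : S.Rel f g) : S.realize f = S.realize g := by
    rw [realize_eq_cls, realize_eq_cls, cls_congr h]
  induction h with
  | refl f => rfl
  | symm h ih => exact ih.symm
  | trans h₁ h₂ ih₁ ih₂ => exact ih₁.trans ih₂
  | compId f => exact Category.comp_id _
  | idComp f => exact Category.id_comp _
  | assoc f g h => exact (Category.assoc _ _ _).symm
  | compInv f => exact Groupoid.comp_inv _
  | invComp f => exact Groupoid.inv_comp _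
  | invCongr h ih => exact congrArg Groupoid.inv ih
  | compCongrLeft g h ih => exact congrArg (· ≫ S.realize g) ih
  | compCongrRight f h ih => exact congrArg (S.realize f ≫ ·) ih
  | apId x => exact sound (Rel.apId x)
  | apCongr h ih => exact sound (Rel.apCongr h)
  | apComp f g => exact sound (Rel.apComp f g)
  | inlId x => rfl
  | inrId x => rfl
  | inlCongr h ih => exact congrArg ULift.up ih
  | inlComp f g => rfl
  | inrCongr h ih => exact congrArg ULift.up ih
  | inrComp f g => rfl
  | pairId x y => rfl
  | pairCongr h₁ h₂ ih₁ ih₂ => exact Prod.ext ih₁ ih₂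
  | pairComp f₁ g₁ f₂ g₂ => rfl
  | homot j x p => exact sound (Rel.homot j x p)
  | pathNatural j p => exact sound (Rel.pathNatural j p)
  | constId x => rfl
  | constComp k l => rfl

end HITSignature

/-! ### The algebra on the W-type -/

namespace HITSignature

variable {K : ι → Grpd.{u, u}} {S : HITSignature K}

theorem realize_fst {P Q : Code ι} : {x y : (Code.prod P Q).Obj K S.W} →
    (f : S.Mor (Code.prod P Q) x y) → S.realize (Mor.fst f) = (S.realize f).1
  | _, _, Mor.id _ _ => rfl
  | _, _, Mor.inv f => congrArg Groupoid.inv (realize_fst f)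
  | _, _, Mor.comp f g => congrArg₂ (· ≫ ·) (realize_fst f) (realize_fst g)
  | _, _, Mor.pair _ _ => rfl

theorem realize_snd {P Q : Code ι} : {x y : (Code.prod P Q).Obj K S.W} →
    (f : S.Mor (Code.prod P Q) x y) → S.realize (Mor.snd f) = (S.realize f).2
  | _, _, Mor.id _ _ => rfl
  | _, _, Mor.inv f => congrArg Groupoid.inv (realize_snd f)
  | _, _, Mor.comp f g => congrArg₂ (· ≫ ·) (realize_snd f) (realize_snd g)
  | _, _, Mor.pair _ _ => rfl

theorem realize_toConst {i : ι} : {x y : (Code.const i).Obj K S.W} → (f : S.Mor (Code.const i) x y) →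
    S.realize f = Mor.toConst f
  | _, _, Mor.id _ _ => rfl
  | _, _, Mor.inv f => congrArg Groupoid.inv (realize_toConst f)
  | _, _, Mor.comp f g => congrArg₂ (· ≫ ·) (realize_toConst f) (realize_toConst g)
  | _, _, Mor.const _ => rfl

variable (S) in
/-- The point operation on the W-type: the algebra map on objects and the class of `Mor.ap` on
morphisms. -/
noncomputable def pointFunctor : S.PointFunctor where
  map f := S.cls (Mor.ap (reify S.point f))
  map_id x := cls_eq_iff.2 ((reify_id S.point x).ap.trans ⟨Rel.apId x⟩)
  map_comp f g := cls_eq_iff.2 ((reify_comp S.point f g).ap.trans ⟨Rel.apComp _ _⟩)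

theorem pointFunctor_map_realize {x y : S.point.Obj K S.W} (f : S.Mor S.point x y) :
    S.pointFunctor.map (S.realize f) = S.cls (Mor.ap f) :=
  cls_eq_iff.2 (reify_realize f).ap

theorem realize_act {P Q : Code ι} (e : Endpoint K S.point P Q) {x y : P.Obj K S.W}
    (f : S.Mor P x y) :
    S.realize (Mor.act e f) = e.map S.pointFunctor.toFunctor (S.realize f) := by
  induction e with
  | id P => rfl
  | comp e₁ e₂ ih₁ ih₂ =>
    exact (ih₂ _).trans (congrArg (e₂.map S.pointFunctor.toFunctor) (ih₁ f))
  | constr => exact (pointFunctor_map_realize f).symm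
  | inl P Q => rfl
  | inr P Q => rfl
  | fst P Q => exact realize_fst f
  | snd P Q => exact realize_snd f
  | pair e₁ e₂ ih₁ ih₂ => exact Prod.ext (ih₁ f) (ih₂ f)
  | const P x => rfl
  | fmap F => exact congrArg F.map (realize_toConst f).symm

variable (S) in
/-- The path operations on the W-type: the classes of `Mor.path`. -/
noncomputable def pathTrans (j : S.PathLabel) :
    (S.pathLeft j).functor S.pointFunctor.toFunctor ⟶
      (S.pathRight j).functor S.pointFunctor.toFunctor where
  app x := S.cls (Mor.path j x)
  naturality x y f := by
    have h := realize_eq_of_rel (Rel.pathNatural j (reify (S.pathArg j) f))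
    have hl := realize_act (S.pathLeft j) (reify (S.pathArg j) f)
    have hr := realize_act (S.pathRight j) (reify (S.pathArg j) f)
    rw [realize_reify] at hl hr
    refine (congrArg (· ≫ S.cls (Mor.path j y)) hl.symm).trans (Eq.trans ?_
      (congrArg (S.cls (Mor.path j x) ≫ ·) hr))
    exact h.symm

theorem realize_interp {R T W : Code ι} {a b : Endpoint K S.point R T} {x : R.Obj K S.W}
    (w : S.Mor T (a.obj S.sup x) (b.obj S.sup x)) {s t : Endpoint K S.point R W}
    (h : HomotEndpoint S.pathLeft S.pathRight a b s t) :
    S.realize (Mor.interp w h) = h.interp S.pointFunctor.toFunctor S.pathTrans (S.realize w) := by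
  induction h with
  | refl e => rfl
  | symm h ih => exact congrArg Groupoid.inv ih
  | trans h₁ h₂ ih₁ ih₂ => exact congrArg₂ (· ≫ ·) ih₁ ih₂
  | ap e h ih => exact (realize_act e _).trans (congrArg (e.map _) ih)
  | assoc _ _ _ => rfl
  | lunit _ => rfl
  | runit _ => rfl
  | pairFst _ _ => rfl
  | pairSnd _ _ => rfl
  | pair h₁ h₂ ih₁ ih₂ => exact Prod.ext ih₁ ih₂
  | compPair _ _ _ => rfl
  | compConst _ _ => rfl
  | path j e => rfl
  | arg => rfl
  | constHom k => rfl
  | fmapHom e α => rfl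

theorem homot_comm (j : S.HomotLabel) (x : (S.homotPointArg j).Obj K S.W)
    (w : (S.argLeft j).obj S.sup x ⟶ (S.argRight j).obj S.sup x) :
    (S.homotLeft j).interp S.pointFunctor.toFunctor S.pathTrans w =
      (S.homotRight j).interp S.pointFunctor.toFunctor S.pathTrans w := by
  obtain ⟨f, rfl⟩ : ∃ f : S.Mor (S.homotPathArg j) ((S.argLeft j).obj S.sup x)
      ((S.argRight j).obj S.sup x), S.realize f = w := ⟨reify _ w, realize_reify _ w⟩
  exact (realize_interp f _).symm.trans
    ((realize_eq_of_rel (Rel.homot j x f)).trans (realize_interp f _))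

variable (S) in
/-- The algebra on the W-type. -/
noncomputable def initialAlgebra : GrpdAlgebra S :=
  ⟨S.W, S.pointFunctor.toFunctor, S.pathTrans, homot_comm⟩

end HITSignature

/-! ### Interpretation of formal morphisms in an algebra -/

namespace HITSignature

variable {K : ι → Grpd.{u, u}} {S : HITSignature K}

section GroupoidCancellation

theorem comp_inv_comp_cancel {C : Type u} [Groupoid.{u} C] {x y z : C} (f : x ⟶ z) (g : y ⟶ z) :
    (f ≫ Groupoid.inv g) ≫ g = f := by
  rw [Category.assoc, Groupoid.inv_comp, Category.comp_id]

theorem inv_comp_eq_comp_inv {C : Type u} [Groupoid.{u} C] {x y z w : C} {f : x ⟶ y} {g : y ⟶ z}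
    {k : x ⟶ w} {l : w ⟶ z} (h : f ≫ g = k ≫ l) :
    Groupoid.inv f ≫ k = g ≫ Groupoid.inv l := by
  rw [Groupoid.inv_eq_inv, Groupoid.inv_eq_inv, IsIso.inv_comp_eq, ← Category.assoc, h]
  simp

end GroupoidCancellation

section Eval

variable (Y : GrpdAlgebra S) (F : S.W → Y.carrier)
  (τ : ∀ x, F (S.sup x) ⟶ Y.point.obj (S.point.mapObj K F x))

/-- The interpretation of formal morphisms in an algebra `Y`, along a map `F` that commutes with
the point operations up to the cells `τ`. -/
def eval : {P : Code ι} → {x y : P.Obj K S.W} → S.Mor P x y →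
    (P.mapObj K F x ⟶ P.mapObj K F y)
  | _, _, _, Mor.id _ _ => 𝟙 _
  | _, _, _, Mor.inv f => Groupoid.inv (eval f)
  | _, _, _, Mor.comp f g => eval f ≫ eval g
  | _, _, _, Mor.inl f => ULift.up (eval f)
  | _, _, _, Mor.inr f => ULift.up (eval f)
  | _, _, _, Mor.pair f g => (eval f, eval g)
  | _, _, _, Mor.path j x =>
    ((S.pathLeft j).cell Y.point F τ x ≫ (Y.path j).app ((S.pathArg j).mapObj K F x)) ≫
      Groupoid.inv ((S.pathRight j).cell Y.point F τ x)
  | _, _, _, Mor.ap (x := x) (y := y) f =>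
    (τ x ≫ Y.point.map (eval f)) ≫ Groupoid.inv (τ y)
  | _, _, _, Mor.const k => k

theorem eval_fst {P Q : Code ι} : {x y : (Code.prod P Q).Obj K S.W} →
    (f : S.Mor (Code.prod P Q) x y) → eval Y F τ (Mor.fst f) = (eval Y F τ f).1
  | _, _, Mor.id _ _ => rfl
  | _, _, Mor.inv f => congrArg Groupoid.inv (eval_fst f)
  | _, _, Mor.comp f g => congrArg₂ (· ≫ ·) (eval_fst f) (eval_fst g)
  | _, _, Mor.pair _ _ => rfl

theorem eval_snd {P Q : Code ι} : {x y : (Code.prod P Q).Obj K S.W} →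
    (f : S.Mor (Code.prod P Q) x y) → eval Y F τ (Mor.snd f) = (eval Y F τ f).2
  | _, _, Mor.id _ _ => rfl
  | _, _, Mor.inv f => congrArg Groupoid.inv (eval_snd f)
  | _, _, Mor.comp f g => congrArg₂ (· ≫ ·) (eval_snd f) (eval_snd g)
  | _, _, Mor.pair _ _ => rfl

theorem eval_toConst {i : ι} : {x y : (Code.const i).Obj K S.W} → (f : S.Mor (Code.const i) x y) →
    eval Y F τ f = Mor.toConst f
  | _, _, Mor.id _ _ => rfl
  | _, _, Mor.inv f => congrArg Groupoid.inv (eval_toConst f)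
  | _, _, Mor.comp f g => congrArg₂ (· ≫ ·) (eval_toConst f) (eval_toConst g)
  | _, _, Mor.const _ => rfl

/-- The cells of an endpoint are natural with respect to formal morphisms. -/
theorem eval_act {P Q : Code ι} (e : Endpoint K S.point P Q) {x y : P.Obj K S.W}
    (f : S.Mor P x y) :
    eval Y F τ (Mor.act e f) ≫ e.cell Y.point F τ y =
      e.cell Y.point F τ x ≫ e.map Y.point (eval Y F τ f) := by
  induction e with
  | id P => exact (Category.comp_id _).trans (Category.id_comp _).symm
  | comp e₁ e₂ ih₁ ih₂ =>
    have h := congrArg (e₂.map Y.point) (ih₁ f)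
    rw [Endpoint.map_comp, Endpoint.map_comp] at h
    exact paste₂ (ih₂ (Mor.act e₁ f)) h
  | constr => exact comp_inv_comp_cancel _ _
  | inl P Q => exact (Category.comp_id _).trans (Category.id_comp _).symm
  | inr P Q => exact (Category.comp_id _).trans (Category.id_comp _).symm
  | fst P Q =>
    exact (Category.comp_id _).trans ((eval_fst Y F τ f).trans (Category.id_comp _).symm)
  | snd P Q =>
    exact (Category.comp_id _).trans ((eval_snd Y F τ f).trans (Category.id_comp _).symm)
  | pair e₁ e₂ ih₁ ih₂ => exact Prod.ext (ih₁ f) (ih₂ f)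
  | const P x => exact (Category.comp_id _).trans (Category.id_comp _).symm
  | fmap G =>
    exact (Category.comp_id _).trans
      ((congrArg G.map (eval_toConst Y F τ f).symm).trans (Category.id_comp _).symm)

theorem eval_path (j : S.PathLabel) (x : (S.pathArg j).Obj K S.W) :
    eval Y F τ (Mor.path j x) ≫ (S.pathRight j).cell Y.point F τ x =
      (S.pathLeft j).cell Y.point F τ x ≫ (Y.path j).app ((S.pathArg j).mapObj K F x) :=
  comp_inv_comp_cancel _ _

/-- The cells of the endpoints `s` and `t` are compatible with the interpretations of a homotopy
endpoint `s ⇒ t` on formal morphisms and in the algebra `Y`. -/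
theorem eval_interp {R T W : Code ι} {a b : Endpoint K S.point R T} {x : R.Obj K S.W}
    (w : S.Mor T (a.obj S.sup x) (b.obj S.sup x))
    (w' : a.obj Y.point.obj (R.mapObj K F x) ⟶ b.obj Y.point.obj (R.mapObj K F x))
    (hw : eval Y F τ w ≫ b.cell Y.point F τ x = a.cell Y.point F τ x ≫ w')
    {s t : Endpoint K S.point R W} (h : HomotEndpoint S.pathLeft S.pathRight a b s t) :
    eval Y F τ (Mor.interp w h) ≫ t.cell Y.point F τ x =
      s.cell Y.point F τ x ≫ h.interp Y.point Y.path w' := by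
  -- the structural homotopy endpoints are identities: it suffices that the two cells agree
  have idc {C : Type u} [Groupoid.{u} C] {x y : C} {f g : x ⟶ y} (h : g = f) :
      𝟙 x ≫ f = g ≫ 𝟙 y := by rw [h, Category.id_comp, Category.comp_id]
  induction h with
  | refl e => exact idc rfl
  | symm h ih =>
    exact inv_comp_eq_comp_inv ih
  | trans h₁ h₂ ih₁ ih₂ => exact paste₆ ih₁ ih₂ rfl
  | ap e h ih =>
    have h' := congrArg (e.map Y.point) ih
    rw [Endpoint.map_comp, Endpoint.map_comp] at h'
    exact paste₂ (eval_act Y F τ e _) h'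
  | assoc e₁ e₂ e₃ =>
    exact idc ((Category.assoc _ _ _).trans
      (congrArg (_ ≫ ·) (e₃.map_comp Y.point _ _).symm))
  | lunit e =>
    exact idc ((congrArg (_ ≫ ·) (e.map_id Y.point _)).trans (Category.comp_id _))
  | runit e => exact idc (Category.id_comp _)
  | pairFst e₁ e₂ => exact idc (Category.id_comp _)
  | pairSnd e₁ e₂ => exact idc (Category.id_comp _)
  | pair h₁ h₂ ih₁ ih₂ => exact Prod.ext ih₁ ih₂
  | compPair e₁ e₂ e₃ => exact idc rfl
  | compConst k e => exact idc (Category.id_comp _)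
  | path j e => exact paste₂ (eval_path Y F τ j _) ((Y.path j).naturality _).symm
  | arg => exact hw
  | constHom k => exact (Category.comp_id _).trans (Category.id_comp _).symm
  | fmapHom e α =>
    exact paste₂ ((Category.comp_id _).trans (Category.id_comp _).symm) (α.naturality _).symm

/-- Congruent formal morphisms have the same interpretation in every algebra. -/
theorem eval_eq_of_rel {P : Code ι} {x y : P.Obj K S.W} {f g : S.Mor P x y} (h : S.Rel f g) :
    eval Y F τ f = eval Y F τ g := by
  induction h with
  | refl f => rfl
  | symm h ih => exact ih.symm
  | trans h₁ h₂ ih₁ ih₂ => exact ih₁.trans ih₂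
  | compId f => exact Category.comp_id _
  | idComp f => exact Category.id_comp _
  | assoc f g h => exact (Category.assoc _ _ _).symm
  | compInv f => exact Groupoid.comp_inv _
  | invComp f => exact Groupoid.inv_comp _
  | invCongr h ih => exact congrArg Groupoid.inv ih
  | compCongrLeft g h ih => exact congrArg (· ≫ eval Y F τ g) ih
  | compCongrRight f h ih => exact congrArg (eval Y F τ f ≫ ·) ih
  | apId x =>
    refine (cancel_mono (τ x)).1 ((comp_inv_comp_cancel _ _).trans ?_)
    refine (congrArg (τ x ≫ ·) (Y.point.map_id _)).trans ?_
    exact (Category.comp_id _).trans (Category.id_comp _).symm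
  | @apCongr x y f g h ih =>
    exact congrArg (fun t => (τ x ≫ Y.point.map t) ≫ Groupoid.inv (τ y)) ih
  | @apComp x y z f g =>
    refine (cancel_mono (τ z)).1 ((comp_inv_comp_cancel _ _).trans ?_)
    refine (congrArg (τ x ≫ ·) (Y.point.map_comp _ _)).trans (Eq.symm ?_)
    exact paste₆ (comp_inv_comp_cancel _ _) (comp_inv_comp_cancel _ _) rfl
  | inlId x => rfl
  | inrId x => rfl
  | inlCongr h ih => exact congrArg ULift.up ih
  | inlComp f g => rfl
  | inrCongr h ih => exact congrArg ULift.up ih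
  | inrComp f g => rfl
  | pairId x y => rfl
  | pairCongr h₁ h₂ ih₁ ih₂ => exact Prod.ext ih₁ ih₂
  | pairComp f₁ g₁ f₂ g₂ => rfl
  | homot j x p =>
    -- `w'` is the interpretation of the path argument, conjugated by the cells of its endpoints
    let w' := (Groupoid.inv ((S.argLeft j).cell Y.point F τ x) ≫ eval Y F τ p) ≫
      (S.argRight j).cell Y.point F τ x
    have hw : eval Y F τ p ≫ (S.argRight j).cell Y.point F τ x =
        (S.argLeft j).cell Y.point F τ x ≫ w' := by
      simp only [w', ← Category.assoc, Groupoid.comp_inv, Category.id_comp]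
    refine (cancel_mono ((S.homotTarget j).cell Y.point F τ x)).1 ?_
    refine (eval_interp Y F τ p w' hw (S.homotLeft j)).trans
      (Eq.trans ?_ (eval_interp Y F τ p w' hw (S.homotRight j)).symm)
    exact congrArg (_ ≫ ·) (Y.homot j _ w')
  | @pathNatural j x y p =>
    refine (cancel_mono ((S.pathRight j).cell Y.point F τ y)).1 ?_
    refine (paste₆ (eval_path Y F τ j x) (eval_act Y F τ (S.pathRight j) p) rfl).trans ?_
    exact (paste₆ (eval_act Y F τ (S.pathLeft j) p) (eval_path Y F τ j y)
      ((Y.path j).naturality _).symm).symm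
  | constId x => rfl
  | constComp k l => rfl

end Eval

end HITSignature

/-! ### Biinitiality -/

namespace HITSignature

variable {K : ι → Grpd.{u, u}} {S : HITSignature K}

section Existence

variable (Y : GrpdAlgebra S) (F : S.W → Y.carrier)
  (τ : ∀ x, F (S.sup x) ⟶ Y.point.obj (S.point.mapObj K F x))

/-- The functor out of the W-type that interprets classes of formal morphisms in `Y`. -/
def evalFunctor : S.W ⥤ Y.carrier where
  obj := F
  map {x y} := Quotient.lift (s := S.setoid x y) (fun f => eval Y F τ f)
    (fun _ _ ⟨h⟩ => eval_eq_of_rel Y F τ h)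
  map_id _ := rfl
  map_comp := by rintro x y z ⟨f⟩ ⟨g⟩; rfl

theorem mapHom_evalFunctor_realize {P : Code ι} {x y : P.Obj K S.W} (f : S.Mor P x y) :
    P.mapHom K (evalFunctor Y F τ) (S.realize f) = eval Y F τ f := by
  induction f with
  | id P x => exact P.mapHom_id K _ x
  | @inv P x y f ih =>
    exact (P.mapHom_inv (evalFunctor Y F τ) (S.realize f)).trans (congrArg Groupoid.inv ih)
  | @comp P x y z f g ihf ihg =>
    exact (P.mapHom_comp K _ _ _).trans (congrArg₂ (· ≫ ·) ihf ihg)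
  | inl f ih => exact congrArg ULift.up ih
  | inr f ih => exact congrArg ULift.up ih
  | pair f g ihf ihg => exact Prod.ext ihf ihg
  | path j x => rfl
  | ap f ih => rfl
  | const k => rfl

/-- The 1-cell from the algebra on the W-type that is determined by a map which commutes with the
point operations up to given cells. -/
noncomputable def evalHom : S.initialAlgebra.Hom Y where
  functor := evalFunctor Y F τ
  pointCell :=
    { app := τ
      naturality := fun x y f => by
        obtain ⟨f, rfl⟩ : ∃ f' : S.Mor S.point x y, S.realize f' = f :=
          ⟨reify _ f, realize_reify _ f⟩
        refine (congrArg (fun t => (evalFunctor Y F τ).map t ≫ τ y)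
          (pointFunctor_map_realize f)).trans ?_
        refine (comp_inv_comp_cancel _ _).trans ?_
        exact congrArg (fun t => τ x ≫ Y.point.map t)
          (mapHom_evalFunctor_realize Y F τ f).symm }
  path_comm j x := eval_path Y F τ j x

end Existence

theorem exists_evalHom (Y : GrpdAlgebra S) : Nonempty (S.initialAlgebra.Hom Y) := by
  obtain ⟨F, hF⟩ := S.exists_rec (M := fun _ => Y.carrier)
    (fun x v => Y.point.obj (S.point.assemble x v))
  exact ⟨evalHom Y F fun x => eqToHom
    ((hF x).trans (congrArg Y.point.obj (S.point.assemble_all F x)))⟩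

section TwoCells

variable {Y : GrpdAlgebra S} (f g : S.initialAlgebra.Hom Y)

/-- A family of morphisms that is compatible with the point cells is natural, not only on `W` but
on `P(W)` for all codes `P`: this generality is what the induction on formal morphisms needs. -/
theorem mapTrans_natural_of_point_comm (θ : ∀ w : S.W, f.functor.obj w ⟶ g.functor.obj w)
    (hθ : ∀ x : S.point.Obj K S.W, θ (S.sup x) ≫ g.pointCell.app x =
      f.pointCell.app x ≫ Y.point.map (S.point.mapTrans K θ x))
    {P : Code ι} {x y : P.Obj K S.W} (m : S.Mor P x y) :
    P.mapHom K f.functor (S.realize m) ≫ P.mapTrans K θ y =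
      P.mapTrans K θ x ≫ P.mapHom K g.functor (S.realize m) := by
  induction m with
  | id P x =>
    refine (congrArg (· ≫ _) (P.mapHom_id K f.functor x)).trans (Eq.trans ?_
      (congrArg (_ ≫ ·) (P.mapHom_id K g.functor x)).symm)
    exact (Category.id_comp _).trans (Category.comp_id _).symm
  | @inv P x y m ih =>
    refine (congrArg (· ≫ _) (P.mapHom_inv f.functor (S.realize m))).trans (Eq.trans ?_
      (congrArg (_ ≫ ·) (P.mapHom_inv g.functor (S.realize m))).symm)
    exact inv_comp_eq_comp_inv ih
  | @comp P x y z m n ihm ihn =>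
    refine (congrArg (· ≫ _) (P.mapHom_comp K f.functor _ _)).trans (Eq.trans ?_
      (congrArg (_ ≫ ·) (P.mapHom_comp K g.functor _ _)).symm)
    exact (paste₂ ihm.symm ihn.symm).symm
  | inl m ih => exact congrArg ULift.up ih
  | inr m ih => exact congrArg ULift.up ih
  | pair m n ihm ihn => exact Prod.ext ihm ihn
  | path j x =>
    have cell {Q : Code ι} (e : Endpoint K S.point (S.pathArg j) Q) :=
      e.mapTrans_cell (c := S.sup) Y.point (τ := f.pointCell.app) (σ := g.pointCell.app) hθ x
    refine (cancel_mono ((S.pathRight j).cell Y.point g.functor.obj g.pointCell.app x)).1 ?_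
    refine (paste₆ (f.path_comm j x) (cell (S.pathRight j)) rfl).trans ?_
    exact (paste₆ (cell (S.pathLeft j)) (g.path_comm j x)
      ((Y.path j).naturality _).symm).symm
  | @ap x y m ih =>
    have cell (k : S.initialAlgebra.Hom Y) : k.functor.map (S.cls (Mor.ap m)) ≫
        k.pointCell.app y = k.pointCell.app x ≫
          Y.point.map (S.point.mapHom K k.functor (S.realize m)) :=
      (congrArg (fun t => k.functor.map t ≫ k.pointCell.app y)
        (pointFunctor_map_realize m).symm).trans (k.pointCell.naturality (S.realize m))
    refine (cancel_mono (g.pointCell.app y)).1 ?_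
    refine (paste₆ (cell f) (hθ y) rfl).trans (paste₆ (hθ x) (cell g) ?_).symm
    exact (Y.point.map_comp _ _).symm.trans ((congrArg Y.point.map ih).trans
      (Y.point.map_comp _ _))
  | const k => exact (Category.comp_id _).trans (Category.id_comp _).symm

theorem exists_hom₂ : Nonempty (GrpdAlgebra.Hom₂ f g) := by
  obtain ⟨θ, h⟩ := S.exists_rec (M := fun w => f.functor.obj w ⟶ g.functor.obj w)
    (fun x v => (f.pointCell.app x ≫ Y.point.map (S.point.assembleHom x v)) ≫
      Groupoid.inv (g.pointCell.app x))
  have hθ : ∀ x : S.point.Obj K S.W, θ (S.sup x) ≫ g.pointCell.app x =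
      f.pointCell.app x ≫ Y.point.map (S.point.mapTrans K θ x) := fun x => by
    rw [h x]
    refine (comp_inv_comp_cancel _ _).trans ?_
    exact congrArg (fun t => f.pointCell.app x ≫ Y.point.map t) (S.point.assembleHom_all θ x)
  exact ⟨{
    trans :=
      { app := θ
        naturality := fun x y m => by
          obtain ⟨m, rfl⟩ : ∃ m' : S.Mor Code.id x y, S.realize m' = m :=
            ⟨reify _ m, realize_reify (S := S) (x := x) (y := y) Code.id m⟩
          exact mapTrans_natural_of_point_comm f g θ hθ m }
    point_comm := hθ }⟩

variable {f g}

theorem hom₂_ext (θ η : GrpdAlgebra.Hom₂ f g) : θ = η := by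
  obtain ⟨r, -⟩ := S.exists_rec
    (M := fun w => ULift.{u} (PLift (θ.trans.app w = η.trans.app w))) (fun x v => ⟨⟨by
      refine (cancel_mono (g.pointCell.app x)).1 ?_
      refine (θ.point_comm x).trans (Eq.trans ?_ (η.point_comm x).symm)
      exact congrArg (fun t => f.pointCell.app x ≫ Y.point.map t)
        (Code.mapTrans_congr θ.trans.app η.trans.app S.point x v)⟩⟩)
  exact GrpdAlgebra.Hom₂.ext (NatTrans.ext (funext fun w => (r w).down.down))

end TwoCells

theorem isBiinitial_initialAlgebra : IsBiinitial S.initialAlgebra where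
  exists_hom := exists_evalHom
  exists_hom₂ f g := exists_hom₂ f g
  hom₂_unique θ η := hom₂_ext θ η

end HITSignature

end GrpdHIT

open GrpdHIT in
/-- Every signature has a biinitial algebra in groupoids, carried by the groupoid on the W-type of
the point polynomial whose morphisms are the classes of formal morphisms. The point operation acts
as the algebra map of the W-type on objects and as `ap` on morphisms; the path operations are
the classes of the formal morphisms `path j x`. -/
theorem mainTheorem4 {ι : Type u} {K : ι → Grpd.{u, u}} (S : HITSignature K) :
    ∃ (c : S.PointFunctor)
      (p : ∀ j, (S.pathLeft j).functor c.toFunctor ⟶ (S.pathRight j).functor c.toFunctor)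
      (h : ∀ (j : S.HomotLabel) (x : (S.homotPointArg j).Obj K S.W)
        (w : (S.argLeft j).obj S.sup x ⟶ (S.argRight j).obj S.sup x),
        (S.homotLeft j).interp c.toFunctor p w = (S.homotRight j).interp c.toFunctor p w),
      (∀ {x y : S.point.Obj K S.W} (f : S.Mor S.point x y),
        c.map (S.realize f) = S.cls (HITSignature.Mor.ap f)) ∧
      (∀ (j : S.PathLabel) (x : (S.pathArg j).Obj K S.W),
        (p j).app x = S.cls (HITSignature.Mor.path j x)) ∧
      IsBiinitial (⟨S.W, c.toFunctor, p, h⟩ : GrpdAlgebra S) :=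
  ⟨S.pointFunctor, S.pathTrans, HITSignature.homot_comm, HITSignature.pointFunctor_map_realize,
    fun _ _ => rfl, HITSignature.isBiinitial_initialAlgebra⟩
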